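/- Let $p$ be a prime, $\kappa$ a perfect field of characteristic $p$, $K_0=\kappa((t))$ with $t$-adic valuation $v_0$ and valuation ring $\mathfrak O_0=\kappa[[t]]$. Let $K_2/K_0$ be a fully ramified cyclic Galois extension of degree $p^2$ with group $G=\langle\sigma_1\rangle$, and put $\sigma_2=\sigma_1^p$. Let $v_2$ be the normalized valuation of $K_2$, $\mathfrak O_2=\{x\in K_2: v_2(x)\ge 0\}$, $\pi$ an element with $v_2(\pi)=1$, and let $b_i=v_2((\sigma_i-1)\pi)-1$ ($i=1,2$) be the lower ramification numbers. Let $\beta_1,\beta_2\in K_0$ and $x_1,x_2\in K_2$ be Artin–Schreier–Witt data for $K_2/K_0$: with $\wp(X)=X^p-X$ and $W(x,y)=\frac{x^p+y^p-(x+y)^p}{p}=-\sum_{i=1}^{p-1}\frac1p\binom pi x^iy^{p-i}$, $$\wp(x_1)=\beta_1,\quad \wp(x_2)=W(x_1,\beta_1)+\beta_2,\quad (\sigma_1-1)x_1=1,\quad (\sigma_1-1)x_2=W(x_1,1),$$ where $\beta_1$ has maximal valuation in $\beta_1+\wp(K_0)$ and $\beta_2$ has maximal valuation in $\beta_2+\mathbb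 F_p\beta_1+\wp(K_0)$. Suppose $\beta_2=\mu^p\beta_1+\epsilon$ with $\mu,\epsilon\in K_0$, where either $\epsilon\in\kappa$, or $v_0(\epsilon)=-e<0$ with $p\nmid e$ and $e\not\equiv b_1 \pmod p$. Assume $$v_0(\epsilon)>v_0(\beta_2)+\tfrac{(p-1)b_1}{p}\quad\text{and}\quad v_0(\beta_1^p)>v_0(\beta_2)+\tfrac{(p-1)b_1}{p}.$$ In $K_0[G]$ put $\Psi_2=\sigma_2-1$ and $\Psi_1=\sigma_1\sum_{i=0}^{p-1}\binom{\mu}{i}(\sigma_2-1)^i-1$. For $0\le a<p^2$ write $a=a_{(0)}+a_{(1)}p$ with $0\le a_{(0)},a_{(1)}<p$, and set $$\Psi^{(a)}=\Psi_2^{a_{(1)}}\Psi_1^{a_{(0)}},\quad \mathfrak b(a)=(1+a_{(1)})b_2+a_{(0)}pb_1,\quad d_a=\lfloor \mathfrak b(a)/p^2\rfloor,$$ and for $0\le j<p^2$ set $w_j=\min\{d_{j+a}-d_a: 0\le a\le j+a<p^2\}$. Let $\mathfrak A=\{\alpha\in K_0[G]:\alpha\mathfrak O_2\subseteq\mathfrak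 O_2\}$ be the associated order of $\mathfrak O_2$. Then $\{t^{-w_j}\Psi^{(j)}\}_{0\le j<p^2}$ is an $\mathfrak O_0$-basis of $\mathfrak A$. Moreover, $\mathfrak O_2$ is a free $\mathfrak A$-module if and only if $w_j=d_j-d_0$ for all $0\le j<p^2$; and in this case every $\rho_*\in K_2$ with $v_2(\rho_*)=r(b_2)$, the least nonnegative residue of $b_2$ modulo $p^2$, is a free generator of $\mathfrak O_2$ over $\mathfrak A$ (that is, $\rho_*\in\mathfrak O_2$ and $\alpha\mapsto\alpha\rho_*$ is a bijection $\mathfrak A\to\mathfrak O_2$). -/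

import Mathlib

open scoped LaurentSeries PowerSeries

noncomputable section

namespace GaloisScaffold

section FieldExtension

variable {K L : Type*} [Field K] [Field L] [Algebra K L]

/-- The action of the group algebra `K[G]`, `G = Gal(L/K)`, on `L`:
the `K`-linear extension of `σ ↦ σ`. -/
def action : MonoidAlgebra K (L ≃ₐ[K] L) →ₐ[K] Module.End K L :=
  MonoidAlgebra.lift K (Module.End K L) (L ≃ₐ[K] L) (DistribMulAction.toModuleEnd K L)

/-- The group element `σ`, seen in `K[G]`. -/
def grp (σ : L ≃ₐ[K] L) : MonoidAlgebra K (L ≃ₐ[K] L) := MonoidAlgebra.of K (L ≃ₐ[K] L) σ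

theorem action_grp (σ : L ≃ₐ[K] L) (x : L) : action (grp σ) x = σ x := by
  simp [action, grp]

/-- The valuation ring `{x ∈ L : v x ≥ 0}`. -/
def valRing (v : AddValuation L (WithTop ℤ)) : Subring L where
  carrier := {x | 0 ≤ v x}
  mul_mem' {a b} ha hb := by
    change 0 ≤ v (a * b)
    rw [v.map_mul]
    exact add_nonneg ha hb
  one_mem' := by simp
  add_mem' {a b} ha hb := v.map_le_add ha hb
  zero_mem' := by simp
  neg_mem' {a} ha := by simpa using ha

/-- The associated order `{α ∈ K[G] : α • 𝔒 ⊆ 𝔒}` of the valuation ring `𝔒` of `v`. -/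
def associatedOrder (K : Type*) {L : Type*} [Field K] [Field L] [Algebra K L]
    (v : AddValuation L (WithTop ℤ)) : Subring (MonoidAlgebra K (L ≃ₐ[K] L)) where
  carrier := {α | ∀ x ∈ valRing v, action α x ∈ valRing v}
  mul_mem' {α β} hα hβ x hx := by
    rw [map_mul]
    exact hα _ (hβ x hx)
  one_mem' x hx := by simpa using hx
  add_mem' {α β} hα hβ x hx := by
    rw [map_add]
    exact add_mem (hα x hx) (hβ x hx)
  zero_mem' x hx := by simp
  neg_mem' {α} hα x hx := by
    rw [map_neg]
    exact neg_mem (hα x hx)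

/-- The valuation ring as a module over its associated order. -/
instance (v : AddValuation L (WithTop ℤ)) : Module (associatedOrder K v) (valRing v) where
  smul α x := ⟨action (α : MonoidAlgebra K (L ≃ₐ[K] L)) (x : L), α.2 x x.2⟩
  one_smul x := Subtype.ext (by change action 1 (x : L) = x; simp)
  mul_smul α β x := Subtype.ext (by
    change action ((α : MonoidAlgebra K (L ≃ₐ[K] L)) * (β : MonoidAlgebra K (L ≃ₐ[K] L)))
      (x : L) = action _ (action _ _)
    simp)
  smul_zero α := Subtype.ext (by change action _ (0 : L) = 0; simp)
  smul_add α x y := Subtype.ext (by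
    change action _ ((x : L) + y) = action _ _ + action _ _
    simp)
  add_smul α β x := Subtype.ext (by
    change action ((α : MonoidAlgebra K (L ≃ₐ[K] L)) + (β : MonoidAlgebra K (L ≃ₐ[K] L)))
      (x : L) = action _ _ + action _ _
    simp)
  zero_smul x := Subtype.ext (by change action 0 (x : L) = 0; simp)

theorem coe_smul (v : AddValuation L (WithTop ℤ)) (α : associatedOrder K v) (x : valRing v) :
    ((α • x : valRing v) : L) = action (α : MonoidAlgebra K (L ≃ₐ[K] L)) (x : L) := rfl

/-- The binomial coefficient `y (y - 1) ⋯ (y - i + 1) / i!`; it is used in characteristic `p`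
with `i < p` only, where `i!` is invertible. -/
def binom (y : K) (i : ℕ) : K := (∏ k ∈ Finset.range i, (y - k)) / (i.factorial : K)

/-- Truncated exponentiation `g^[y] = ∑_{i < p} binom(y, i) (g - 1)^i`. -/
def truncPow (p : ℕ) {A : Type*} [Ring A] [Algebra K A] (g : A) (y : K) : A :=
  ∑ i ∈ Finset.range p, binom y i • (g - 1) ^ i

/-- `Ψ₁ = σ₁ σ₂^[μ] - 1`. -/
def Psi₁ (p : ℕ) (σ₁ σ₂ : L ≃ₐ[K] L) (μ : K) : MonoidAlgebra K (L ≃ₐ[K] L) :=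
  grp σ₁ * truncPow p (grp σ₂) μ - 1

/-- `Ψ₂ = σ₂ - 1`. -/
def Psi₂ (σ₂ : L ≃ₐ[K] L) : MonoidAlgebra K (L ≃ₐ[K] L) := grp σ₂ - 1

/-- `Ψ^(a) = Ψ₂^{a₁} Ψ₁^{a₀}` for `a = a₀ + a₁ p < p²` with digits `0 ≤ a₀, a₁ < p`. -/
def Psi (p : ℕ) (σ₁ σ₂ : L ≃ₐ[K] L) (μ : K) (a : ℕ) : MonoidAlgebra K (L ≃ₐ[K] L) :=
  Psi₂ σ₂ ^ (a / p) * Psi₁ p σ₁ σ₂ μ ^ (a % p)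

end FieldExtension

/-- The polynomial `(x^p + y^p - (x + y)^p) / p = -∑_{i=1}^{p-1} (1/p) binom(p, i) x^i y^{p-i}`
with integer coefficients, evaluated at `x, y`. -/
def wittPoly {R : Type*} [CommRing R] (p : ℕ) (x y : R) : R :=
  -∑ i ∈ Finset.Ico 1 p, ((p.choose i / p : ℕ) : R) * x ^ i * y ^ (p - i)

/-- `v` is the normalized valuation of the finite extension `L` of `κ((t))` (with value group `ℤ`,
and extending a multiple of the `t`-adic valuation) and `L / κ((t))` is fully ramified, i.e. the
ramification index is the degree. -/
structure IsFullyRamifiedValuation (κ : Type*) {L : Type*} [Field κ] [Field L] [Algebra κ⸨X⸩ L]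
    (v : AddValuation L (WithTop ℤ)) : Prop where
  normalized : ∀ n : ℤ, ∃ x : L, v x = n
  ramification : ∀ a : κ⸨X⸩, v (algebraMap κ⸨X⸩ L a) = Module.finrank κ⸨X⸩ L • a.orderTop

/-- `𝔟(a) = (1 + a₁) b₂ + a₀ p b₁` for `a = a₀ + a₁ p < p²` with digits `0 ≤ a₀, a₁ < p`. -/
def bb (p : ℕ) (b₁ b₂ : ℤ) (a : ℕ) : ℤ :=
  (1 + ((a / p : ℕ) : ℤ)) * b₂ + ((a % p : ℕ) : ℤ) * p * b₁

/-- `d_a = ⌊𝔟(a) / p²⌋`. -/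
def dd (p : ℕ) (b₁ b₂ : ℤ) (a : ℕ) : ℤ := ⌊(bb p b₁ b₂ a : ℚ) / (p : ℚ) ^ 2⌋

/-- `w_j = min {d_{j+a} - d_a : 0 ≤ a ≤ j + a < p²}`, for `0 ≤ j < p²`. -/
def ww (p : ℕ) (b₁ b₂ : ℤ) (j : Fin (p ^ 2)) : ℤ :=
  (Finset.range (p ^ 2 - j)).inf' (by have := j.2; simp; omega)
    (fun a => dd p b₁ b₂ (j + a) - dd p b₁ b₂ a)

end GaloisScaffold

end

noncomputable section

namespace GaloisScaffold

section AddVal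

variable {L : Type*} [Field L] (v : AddValuation L (WithTop ℤ))

theorem exists_val_eq {x : L} (hx : x ≠ 0) : ∃ k : ℤ, v x = (k : WithTop ℤ) := by
  have := (v.ne_top_iff).2 hx
  obtain ⟨k, hk⟩ := WithTop.ne_top_iff_exists.1 this
  exact ⟨k, hk.symm⟩

theorem coe_lt_iff {k : ℤ} {w : WithTop ℤ} :
    (k : WithTop ℤ) < w ↔ ((k + 1 : ℤ) : WithTop ℤ) ≤ w := by
  cases w with
  | top => simp
  | coe w => norm_cast

variable {v}

theorem le_val_mul {x y : L} {a b : ℤ} (hx : (a : WithTop ℤ) ≤ v x) (hy : (b : WithTop ℤ) ≤ v y) :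
    ((a + b : ℤ) : WithTop ℤ) ≤ v (x * y) := by
  rw [v.map_mul, WithTop.coe_add]
  exact add_le_add hx hy

theorem val_mul_eq {x y : L} {a b : ℤ} (hx : v x = a) (hy : v y = b) :
    v (x * y) = ((a + b : ℤ) : WithTop ℤ) := by
  rw [v.map_mul, WithTop.coe_add, hx, hy]

theorem le_val_prod {ι : Type*} {s : Finset ι} {f : ι → L} {a : ι → ℤ}
    (h : ∀ i ∈ s, (a i : WithTop ℤ) ≤ v (f i)) :
    ((∑ i ∈ s, a i : ℤ) : WithTop ℤ) ≤ v (∏ i ∈ s, f i) := by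
  classical
  induction s using Finset.induction_on with
  | empty => simp
  | insert i s hi ih =>
    rw [Finset.prod_insert hi, Finset.sum_insert hi]
    exact le_val_mul (h i (by simp)) (ih fun j hj => h j (by simp [hj]))

theorem val_prod_eq {ι : Type*} {s : Finset ι} {f : ι → L} {a : ι → ℤ}
    (h : ∀ i ∈ s, v (f i) = a i) :
    v (∏ i ∈ s, f i) = ((∑ i ∈ s, a i : ℤ) : WithTop ℤ) := by
  classical
  induction s using Finset.induction_on with
  | empty => simp
  | insert i s hi ih =>
    rw [Finset.prod_insert hi, Finset.sum_insert hi]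
    exact val_mul_eq (h i (by simp)) (ih fun j hj => h j (by simp [hj]))

theorem le_val_pow {x : L} {a : ℤ} (hx : (a : WithTop ℤ) ≤ v x) (k : ℕ) :
    ((k * a : ℤ) : WithTop ℤ) ≤ v (x ^ k) := by
  have := le_val_prod (v := v) (s := Finset.range k) (f := fun _ => x) (a := fun _ => a)
    (fun _ _ => hx)
  simpa using this

theorem val_pow_eq {x : L} {a : ℤ} (hx : v x = a) (k : ℕ) :
    v (x ^ k) = ((k * a : ℤ) : WithTop ℤ) := by
  have := val_prod_eq (v := v) (s := Finset.range k) (f := fun _ => x) (a := fun _ => a)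
    (fun _ _ => hx)
  simpa using this

theorem val_natCast_nonneg (k : ℕ) : 0 ≤ v (k : L) := by
  induction k with
  | zero => simp
  | succ k ih => rw [Nat.cast_succ]; exact v.map_le_add ih (by simp)

theorem val_add_eq {x y : L} {a : ℤ} (hx : v x = a) (hy : ((a + 1 : ℤ) : WithTop ℤ) ≤ v y) :
    v (x + y) = a := by
  rw [v.map_add_eq_of_lt_left, hx]
  rw [hx]
  exact coe_lt_iff.2 hy

theorem val_sub_eq {x y : L} {a : ℤ} (hx : v x = a) (hy : ((a + 1 : ℤ) : WithTop ℤ) ≤ v y) :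
    v (x - y) = a := by
  rw [sub_eq_add_neg]
  exact val_add_eq hx (by rwa [v.map_neg])

end AddVal

section Ramified

variable {κ : Type*} [Field κ] {L : Type*} [Field L] [Algebra κ⸨X⸩ L]
  {v : AddValuation L (WithTop ℤ)} (hv : IsFullyRamifiedValuation κ v)

include hv

theorem IsFullyRamifiedValuation.val_algebraMap {a : κ⸨X⸩} {k : ℤ} (ha : a.orderTop = k) :
    v (algebraMap κ⸨X⸩ L a) = (((Module.finrank κ⸨X⸩ L : ℤ) * k : ℤ) : WithTop ℤ) := by
  rw [hv.ramification, ha, ← WithTop.coe_nsmul, nsmul_eq_mul]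

theorem IsFullyRamifiedValuation.exists_val_algebraMap {a : κ⸨X⸩} (ha : a ≠ 0) :
    ∃ k : ℤ, a.orderTop = k ∧
      v (algebraMap κ⸨X⸩ L a) = (((Module.finrank κ⸨X⸩ L : ℤ) * k : ℤ) : WithTop ℤ) := by
  obtain ⟨k, hk⟩ := WithTop.ne_top_iff_exists.1 (HahnSeries.orderTop_ne_top.2 ha)
  exact ⟨k, hk.symm, hv.val_algebraMap hk.symm⟩

omit hv in
theorem val_smul (c : κ⸨X⸩) (y : L) : v (c • y) = v (algebraMap κ⸨X⸩ L c) + v y := by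
  rw [Algebra.smul_def, v.map_mul]

theorem IsFullyRamifiedValuation.exists_val_smul {c : κ⸨X⸩} (hc : c ≠ 0) {y : L} {e : ℤ}
    (hy : v y = e) : ∃ k : ℤ, c.orderTop = k ∧
      v (c • y) = (((Module.finrank κ⸨X⸩ L : ℤ) * k + e : ℤ) : WithTop ℤ) := by
  obtain ⟨k, hk, hk'⟩ := hv.exists_val_algebraMap hc
  exact ⟨k, hk, by rw [val_smul, hk', hy, WithTop.coe_add]⟩

/-- A lower bound for `v (c • y)` can be improved using that the values of scalars are multiples
of the degree. -/
theorem IsFullyRamifiedValuation.le_val_smul_of_le {c : κ⸨X⸩} {y : L} {e m m' : ℤ} (hy : v y = e)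
    (h : (m : WithTop ℤ) ≤ v (c • y))
    (hm : ∀ k : ℤ, m ≤ (Module.finrank κ⸨X⸩ L : ℤ) * k + e →
      m' ≤ (Module.finrank κ⸨X⸩ L : ℤ) * k + e) :
    (m' : WithTop ℤ) ≤ v (c • y) := by
  by_cases hc : c = 0
  · simp [hc]
  · obtain ⟨k, -, hk⟩ := hv.exists_val_smul hc hy
    rw [hk] at h ⊢
    exact_mod_cast hm k (by exact_mod_cast h)

variable {ι : Type*} [Fintype ι] {y : ι → L} {e : ι → ℤ} (hy : ∀ i, v (y i) = e i)
  (he : ∀ i j, (Module.finrank κ⸨X⸩ L : ℤ) ∣ e i - e j → i = j)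

include hy he

theorem IsFullyRamifiedValuation.exists_dominant {c : ι → κ⸨X⸩} (hc : c ≠ 0) :
    ∃ i, c i ≠ 0 ∧ v (∑ j, c j • y j) = v (c i • y i) ∧
      ∀ j, j ≠ i → v (c i • y i) < v (c j • y j) := by
  classical
  obtain ⟨i₀, hi₀⟩ := Function.ne_iff.1 hc
  have : Nonempty ι := ⟨i₀⟩
  obtain ⟨i, hi⟩ := Finite.exists_min (fun j => v (c j • y j))
  obtain ⟨k₀, -, hk₀⟩ := hv.exists_val_smul hi₀ (hy i₀)
  have hci : c i ≠ 0 := by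
    intro h
    have := hi i₀
    rw [hk₀, h, zero_smul, v.map_zero, top_le_iff] at this
    exact WithTop.coe_ne_top this
  obtain ⟨k, -, hk⟩ := hv.exists_val_smul hci (hy i)
  have hlt : ∀ j, j ≠ i → v (c i • y i) < v (c j • y j) := by
    intro j hj
    refine lt_of_le_of_ne (hi j) fun h => hj ?_
    by_cases hcj : c j = 0
    · rw [hk, hcj, zero_smul, v.map_zero] at h
      exact (WithTop.coe_ne_top h).elim
    obtain ⟨l, -, hl⟩ := hv.exists_val_smul hcj (hy j)
    rw [hk, hl] at h
    have h' := WithTop.coe_injective h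
    apply he
    exact ⟨k - l, by linarith⟩
  refine ⟨i, hci, ?_, hlt⟩
  rw [← Finset.add_sum_erase _ _ (Finset.mem_univ i), v.map_add_eq_of_lt_left]
  exact v.map_lt_sum (by rw [hk]; exact WithTop.coe_ne_top) fun j hj => hlt j (Finset.ne_of_mem_erase hj)

theorem IsFullyRamifiedValuation.le_val_sum_iff (c : ι → κ⸨X⸩) (m : WithTop ℤ) :
    m ≤ v (∑ j, c j • y j) ↔ ∀ j, m ≤ v (c j • y j) := by
  refine ⟨fun h j => ?_, fun h => v.map_le_sum fun j _ => h j⟩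
  by_cases hc : c = 0
  · simp [hc]
  obtain ⟨i, -, h₁, h₂⟩ := hv.exists_dominant hy he hc
  rw [h₁] at h
  rcases eq_or_ne j i with rfl | hj
  · exact h
  · exact h.trans (h₂ j hj).le

theorem IsFullyRamifiedValuation.linearIndependent_of_val : LinearIndependent κ⸨X⸩ y := by
  rw [Fintype.linearIndependent_iff]
  intro c hc i
  have := (hv.le_val_sum_iff hy he c ⊤).1 (by simp [hc]) i
  rw [top_le_iff, v.top_iff, smul_eq_zero] at this
  refine this.resolve_right fun h => ?_
  have := hy i
  simp [h] at this

theorem IsFullyRamifiedValuation.exists_sum_eq [FiniteDimensional κ⸨X⸩ L]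
    (hcard : Fintype.card ι = Module.finrank κ⸨X⸩ L) (z : L) :
    ∃ c : ι → κ⸨X⸩, z = ∑ i, c i • y i := by
  have := (hv.linearIndependent_of_val hy he).span_eq_top_of_card_eq_finrank' hcard
  have hz : z ∈ Submodule.span κ⸨X⸩ (Set.range y) := by rw [this]; trivial
  obtain ⟨c, hc⟩ := (Submodule.mem_span_range_iff_exists_fun _).1 hz
  exact ⟨c, hc.symm⟩

end Ramified

section Uniformizer

variable {κ : Type*} [Field κ] {L : Type*} [Field L] [Algebra κ⸨X⸩ L] [FiniteDimensional κ⸨X⸩ L]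
  {v : AddValuation L (WithTop ℤ)} (hv : IsFullyRamifiedValuation κ v)
  {π : L} (hπ : v π = 1)

omit [FiniteDimensional κ⸨X⸩ L] in
theorem fin_eq_of_dvd_sub {n : ℕ} {i j : Fin n} (h : (n : ℤ) ∣ (i : ℤ) - (j : ℤ)) : i = j := by
  have hi := i.2
  have hj := j.2
  have := Int.eq_zero_of_abs_lt_dvd h (by rw [abs_lt]; omega)
  ext
  omega

include hv hπ

omit hv [FiniteDimensional κ⸨X⸩ L] in
theorem val_uniformizer_pow (i : ℕ) : v (π ^ i) = ((i : ℤ) : WithTop ℤ) := by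
  have := val_pow_eq (v := v) (x := π) (a := 1) (by simpa using hπ) i
  simpa using this

theorem IsFullyRamifiedValuation.exists_sum_uniformizer (z : L) :
    ∃ c : Fin (Module.finrank κ⸨X⸩ L) → κ⸨X⸩, z = ∑ i, c i • π ^ (i : ℕ) :=
  hv.exists_sum_eq (y := fun i : Fin (Module.finrank κ⸨X⸩ L) => π ^ (i : ℕ))
    (e := fun i => ((i : ℕ) : ℤ)) (fun i => val_uniformizer_pow hπ i)
    (fun _ _ h => fin_eq_of_dvd_sub h) (by simp) z

omit [FiniteDimensional κ⸨X⸩ L] in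
theorem IsFullyRamifiedValuation.le_val_sum_uniformizer_iff
    (c : Fin (Module.finrank κ⸨X⸩ L) → κ⸨X⸩) (m : WithTop ℤ) :
    m ≤ v (∑ i, c i • π ^ (i : ℕ)) ↔ ∀ i, m ≤ v (c i • π ^ (i : ℕ)) :=
  hv.le_val_sum_iff (y := fun i : Fin (Module.finrank κ⸨X⸩ L) => π ^ (i : ℕ))
    (e := fun i => ((i : ℕ) : ℤ)) (fun i => val_uniformizer_pow hπ i)
    (fun _ _ h => fin_eq_of_dvd_sub h) c m

theorem IsFullyRamifiedValuation.one_le_val_algEquiv_uniformizer (σ : L ≃ₐ[κ⸨X⸩] L) :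
    1 ≤ v (σ π) := by
  set n := Module.finrank κ⸨X⸩ L with hn
  have hn0 : 0 < n := Module.finrank_pos
  obtain ⟨c, hc⟩ := hv.exists_sum_uniformizer hπ (π ^ n)
  have hπ0 : π ≠ 0 := by
    rintro rfl
    simp at hπ
  obtain ⟨k, hk⟩ := exists_val_eq v (x := σ π) (by simpa using hπ0)
  have hcv := (hv.le_val_sum_uniformizer_iff hπ c ((n : ℤ) : WithTop ℤ)).1
    (by rw [← hc, val_uniformizer_pow hπ])
  have hca : ∀ i, ((n : ℤ) : WithTop ℤ) ≤ v (algebraMap κ⸨X⸩ L (c i)) := by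
    intro i
    by_cases h0 : c i = 0
    · simp [h0]
    obtain ⟨l, -, hl⟩ := hv.exists_val_algebraMap h0
    have := hcv i
    rw [val_smul, hl, val_uniformizer_pow hπ, ← WithTop.coe_add] at this
    rw [hl]
    have h1 : (n : ℤ) ≤ n * l + (i : ℕ) := by exact_mod_cast this
    have h2 : (i : ℕ) < n := i.2
    have h3 : 1 ≤ l := by
      by_contra hl0
      nlinarith
    have : (n : ℤ) ≤ n * l := by nlinarith
    exact_mod_cast this
  rw [hk]
  by_contra hk1
  have hk0 : k ≤ 0 := by
    have : ¬ (1 : ℤ) ≤ k := fun h => hk1 (by exact_mod_cast h)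
    omega
  have h1 : σ π ^ n = ∑ i, c i • σ π ^ (i : ℕ) := by
    rw [← map_pow, hc, map_sum]
    simp
  have h2 : ((n + (n - 1) * k : ℤ) : WithTop ℤ) ≤ v (σ π ^ n) := by
    rw [h1]
    refine v.map_le_sum fun i _ => ?_
    rw [Algebra.smul_def]
    refine le_trans ?_ (le_val_mul (hca i) (le_val_pow hk.ge i))
    have h2 : (i : ℕ) < n := i.2
    have : (n + (n - 1) * k : ℤ) ≤ n + (i : ℕ) * k := by nlinarith
    exact_mod_cast this
  rw [val_pow_eq hk] at h2
  have h3 : (n + (n - 1) * k : ℤ) ≤ n * k := by exact_mod_cast h2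
  nlinarith

theorem IsFullyRamifiedValuation.le_val_algEquiv (σ : L ≃ₐ[κ⸨X⸩] L) (z : L) :
    v z ≤ v (σ z) := by
  obtain ⟨c, hc⟩ := hv.exists_sum_uniformizer hπ z
  have h := (hv.le_val_sum_uniformizer_iff hπ c (v z)).1 (by rw [← hc])
  conv_rhs => rw [hc, map_sum]
  refine v.map_le_sum fun i _ => (h i).trans ?_
  rw [map_smul σ, val_smul, val_smul]
  gcongr
  rw [val_uniformizer_pow hπ, map_pow]
  have := le_val_pow (v := v) (a := 1)
    (by exact_mod_cast hv.one_le_val_algEquiv_uniformizer hπ σ) (i : ℕ)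
  simpa using this

theorem IsFullyRamifiedValuation.val_algEquiv (σ : L ≃ₐ[κ⸨X⸩] L) (z : L) : v (σ z) = v z := by
  refine le_antisymm ?_ (hv.le_val_algEquiv hπ σ z)
  have := hv.le_val_algEquiv hπ σ.symm (σ z)
  simpa using this

theorem IsFullyRamifiedValuation.exists_residue {z : L} (hz : 0 ≤ v z) :
    ∃ c : κ, 1 ≤ v (z - algebraMap κ⸨X⸩ L (HahnSeries.C c)) := by
  set n := Module.finrank κ⸨X⸩ L with hn
  have hn0 : 0 < n := Module.finrank_pos
  obtain ⟨c, hc⟩ := hv.exists_sum_uniformizer hπ z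
  have h := (hv.le_val_sum_uniformizer_iff hπ c 0).1 (by rw [← hc]; exact hz)
  refine ⟨(c ⟨0, hn0⟩).coeff 0, ?_⟩
  rw [hc, ← Finset.add_sum_erase _ _ (Finset.mem_univ (⟨0, hn0⟩ : Fin n)), add_sub_right_comm]
  refine v.map_le_add ?_ (v.map_le_sum fun i hi => ?_)
  · have h0 := h ⟨0, hn0⟩
    simp only [pow_zero] at h0 ⊢
    rw [← Algebra.algebraMap_eq_smul_one] at h0 ⊢
    rw [← map_sub]
    by_cases hd : c ⟨0, hn0⟩ - HahnSeries.C ((c ⟨0, hn0⟩).coeff 0) = 0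
    · rw [hd, map_zero, v.map_zero]
      exact le_top
    have hpos : ∀ j : ℤ, j < 0 → (c ⟨0, hn0⟩).coeff j = 0 := by
      intro j hj
      apply HahnSeries.coeff_eq_zero_of_lt_orderTop
      by_cases h0' : c ⟨0, hn0⟩ = 0
      · rw [h0']; simp
      obtain ⟨k, hk, hk'⟩ := hv.exists_val_algebraMap h0'
      rw [hk'] at h0
      rw [hk]
      have h1 : (0 : ℤ) ≤ n * k := by exact_mod_cast h0
      have : j < k := by nlinarith
      exact_mod_cast this
    obtain ⟨k, hk, hk'⟩ := hv.exists_val_algebraMap hd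
    rw [hk']
    have hne := HahnSeries.coeff_orderTop_ne hk
    have hk1 : 1 ≤ k := by
      by_contra hk1
      rcases (show k < 0 ∨ k = 0 by omega) with hk0 | rfl
      · apply hne
        rw [HahnSeries.coeff_sub, hpos k hk0, HahnSeries.C_apply, HahnSeries.coeff_single_of_ne]
        · simp
        · omega
      · apply hne
        simp [HahnSeries.C_apply]
    have : (1 : ℤ) ≤ n * k := by nlinarith
    exact_mod_cast this
  · have := hv.le_val_smul_of_le (m := 0) (m' := 1) (val_uniformizer_pow hπ i)
      (by exact_mod_cast h i) ?_
    · exact_mod_cast this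
    intro k hk
    have h2 : (i : ℕ) < n := i.2
    have h3 : 0 < (i : ℕ) := by
      rcases Nat.eq_zero_or_pos (i : ℕ) with h0 | h0
      · exact absurd (Fin.ext h0) (Finset.ne_of_mem_erase hi)
      · exact h0
    rcases eq_or_lt_of_le hk with h4 | h4
    · exfalso
      have : k < 0 := by nlinarith
      nlinarith
    · linarith

omit [FiniteDimensional κ⸨X⸩ L] hπ in
theorem IsFullyRamifiedValuation.val_natCast {p : ℕ} [CharP κ p] {i : ℕ} (hi : ¬ p ∣ i) :
    v (i : L) = 0 := by
  have h1 : (i : κ) ≠ 0 := by rwa [Ne, CharP.cast_eq_zero_iff κ p]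
  have h2 : (i : κ⸨X⸩).orderTop = ((0 : ℤ) : WithTop ℤ) := by
    rw [← map_natCast (HahnSeries.C : κ →+* κ⸨X⸩), HahnSeries.C_apply,
      HahnSeries.orderTop_single h1]
  have := hv.val_algebraMap h2
  simpa using this

end Uniformizer

section Ramification

variable {κ : Type*} [Field κ] {L : Type*} [Field L] [Algebra κ⸨X⸩ L] [FiniteDimensional κ⸨X⸩ L]
  {v : AddValuation L (WithTop ℤ)} (hv : IsFullyRamifiedValuation κ v)
  {π : L} (hπ : v π = 1) {σ : L ≃ₐ[κ⸨X⸩] L} {b : ℤ}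
  (hb : v (σ π - π) = ((b + 1 : ℤ) : WithTop ℤ))

include hπ hb

omit [FiniteDimensional κ⸨X⸩ L] in
theorem exists_algEquiv_uniformizer_eq :
    ∃ w : L, v w = b ∧ ∀ i : ℕ,
      σ (π ^ i) - π ^ i = π ^ i * ((∑ j ∈ Finset.range i, (1 + w) ^ j) * w) := by
  have hπ0 : π ≠ 0 := by
    rintro rfl
    simp at hπ
  refine ⟨(σ π - π) / π, ?_, fun i => ?_⟩
  · have h1 : (σ π - π) / π ≠ 0 := by
      refine div_ne_zero (fun h => ?_) hπ0
      rw [h, v.map_zero] at hb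
      exact WithTop.coe_ne_top hb.symm
    obtain ⟨k, hk⟩ := exists_val_eq v h1
    have h2 := val_mul_eq hk (b := 1) (by exact_mod_cast hπ)
    rw [div_mul_cancel₀ _ hπ0, hb] at h2
    have : b + 1 = k + 1 := by exact_mod_cast h2
    rw [hk]
    congr 1
    omega
  · have h := geom_sum_mul (1 + (σ π - π) / π) i
    rw [add_sub_cancel_left] at h
    rw [h, map_pow, mul_sub, ← mul_pow, mul_add, mul_div_cancel₀ _ hπ0]
    ring

omit [FiniteDimensional κ⸨X⸩ L] in
theorem le_val_sub_uniformizer_pow (hb0 : 0 ≤ b) (i : ℕ) :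
    ((i + b : ℤ) : WithTop ℤ) ≤ v (σ (π ^ i) - π ^ i) := by
  obtain ⟨w, hw, h⟩ := exists_algEquiv_uniformizer_eq hπ hb
  have hw0 : 0 ≤ v w := by rw [hw]; exact_mod_cast hb0
  have h1 : 0 ≤ v (1 + w) := v.map_le_add (by simp) hw0
  have h2 : ((0 : ℤ) : WithTop ℤ) ≤ v (∑ j ∈ Finset.range i, (1 + w) ^ j) := by
    refine v.map_le_sum fun j _ => ?_
    simpa using le_val_pow (v := v) (a := 0) (by simpa using h1) j
  rw [h i]
  have := le_val_mul (val_uniformizer_pow hπ i).ge (le_val_mul h2 hw.ge)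
  simpa using this

include hv

omit [FiniteDimensional κ⸨X⸩ L] in
theorem IsFullyRamifiedValuation.val_sub_uniformizer_pow {p : ℕ} [CharP κ p] (hb1 : 1 ≤ b) {i : ℕ}
    (hi : ¬ p ∣ i) : v (σ (π ^ i) - π ^ i) = ((i + b : ℤ) : WithTop ℤ) := by
  obtain ⟨w, hw, h⟩ := exists_algEquiv_uniformizer_eq hπ hb
  have hw0 : ((1 : ℤ) : WithTop ℤ) ≤ v w := by rw [hw]; exact_mod_cast hb1
  have h1 : 0 ≤ v (1 + w) := v.map_le_add (by simp) (le_trans (by norm_num) hw0)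
  have hs : ∀ k : ℕ, ((0 : ℤ) : WithTop ℤ) ≤ v (∑ j ∈ Finset.range k, (1 + w) ^ j) := by
    intro k
    refine v.map_le_sum fun j _ => ?_
    simpa using le_val_pow (v := v) (a := 0) (by simpa using h1) j
  have h2 : v (∑ j ∈ Finset.range i, (1 + w) ^ j) = ((0 : ℤ) : WithTop ℤ) := by
    have h3 : ∑ j ∈ Finset.range i, (1 + w) ^ j =
        (i : L) + ∑ j ∈ Finset.range i, ((1 + w) ^ j - 1) := by
      simp
    rw [h3]
    refine val_add_eq (by simpa using hv.val_natCast hi) (v.map_le_sum fun j _ => ?_)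
    have h4 := geom_sum_mul (1 + w) j
    rw [add_sub_cancel_left] at h4
    rw [← h4]
    exact le_val_mul (hs j) hw0
  rw [h i]
  have := val_mul_eq (val_uniformizer_pow hπ i) (val_mul_eq h2 hw)
  simpa using this

theorem IsFullyRamifiedValuation.le_val_sub (hb0 : 0 ≤ b) {z : L} {k : ℤ}
    (hz : (k : WithTop ℤ) ≤ v z) : ((k + b : ℤ) : WithTop ℤ) ≤ v (σ z - z) := by
  obtain ⟨c, hc⟩ := hv.exists_sum_uniformizer hπ z
  have h := (hv.le_val_sum_uniformizer_iff hπ c k).1 (by rw [← hc]; exact hz)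
  have h1 : σ z - z = ∑ i, c i • (σ (π ^ (i : ℕ)) - π ^ (i : ℕ)) := by
    simp only [smul_sub, Finset.sum_sub_distrib]
    rw [← hc]
    conv_lhs => rw [hc, map_sum]
    simp only [map_smul σ]
    rw [← hc]
  rw [h1]
  refine v.map_le_sum fun i _ => ?_
  by_cases h0 : c i = 0
  · simp [h0]
  obtain ⟨l, -, hl⟩ := hv.exists_val_algebraMap h0
  have h2 := h i
  rw [val_smul, hl, val_uniformizer_pow hπ, ← WithTop.coe_add] at h2
  have h3 := le_val_mul hl.ge (le_val_sub_uniformizer_pow hπ hb hb0 i)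
  rw [← Algebra.smul_def] at h3
  refine le_trans ?_ h3
  have : k ≤ Module.finrank κ⸨X⸩ L * l + (i : ℕ) := by exact_mod_cast h2
  exact_mod_cast (by linarith)

theorem IsFullyRamifiedValuation.val_sub_eq {p : ℕ} [CharP κ p]
    (hp : p ∣ Module.finrank κ⸨X⸩ L) (hb1 : 1 ≤ b) {z : L} {k : ℤ}
    (hz : v z = k) (hk : ¬ (p : ℤ) ∣ k) : v (σ z - z) = ((k + b : ℤ) : WithTop ℤ) := by
  classical
  obtain ⟨c, hc⟩ := hv.exists_sum_uniformizer hπ z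
  have hc0 : c ≠ 0 := by
    rintro rfl
    simp only [Pi.zero_apply, zero_smul, Finset.sum_const_zero] at hc
    rw [hc, v.map_zero] at hz
    exact WithTop.coe_ne_top hz.symm
  obtain ⟨i, hi0, hi1, hi2⟩ := hv.exists_dominant
    (y := fun i : Fin (Module.finrank κ⸨X⸩ L) => π ^ (i : ℕ))
    (e := fun i => ((i : ℕ) : ℤ)) (fun i => val_uniformizer_pow hπ i)
    (fun _ _ h => fin_eq_of_dvd_sub h) hc0
  rw [← hc, hz] at hi1
  rw [← hi1] at hi2
  obtain ⟨l, -, hl⟩ := hv.exists_val_algebraMap hi0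
  have hkl : k = Module.finrank κ⸨X⸩ L * l + (i : ℕ) := by
    rw [val_smul, hl, val_uniformizer_pow hπ, ← WithTop.coe_add] at hi1
    exact_mod_cast hi1
  have hpi : ¬ p ∣ (i : ℕ) := by
    intro h
    apply hk
    rw [hkl]
    exact dvd_add (Dvd.dvd.mul_right (by exact_mod_cast hp) _) (by exact_mod_cast h)
  have h1 : z = c i • π ^ (i : ℕ) + ∑ j ∈ Finset.univ.erase i, c j • π ^ (j : ℕ) := by
    rw [hc]
    exact (Finset.add_sum_erase _ _ (Finset.mem_univ i)).symm
  set r := ∑ j ∈ Finset.univ.erase i, c j • π ^ (j : ℕ) with hr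
  have hrv : ((k + 1 : ℤ) : WithTop ℤ) ≤ v r :=
    v.map_le_sum fun j hj => coe_lt_iff.1 (hi2 j (Finset.ne_of_mem_erase hj))
  have h2 : σ z - z = c i • (σ (π ^ (i : ℕ)) - π ^ (i : ℕ)) + (σ r - r) := by
    rw [h1, map_add, map_smul σ, smul_sub]
    ring
  rw [h2]
  refine val_add_eq ?_ ?_
  · rw [Algebra.smul_def, val_mul_eq hl (hv.val_sub_uniformizer_pow hπ hb hb1 hpi), hkl, add_assoc]
  · have := hv.le_val_sub hπ hb (by omega) hrv
    rwa [add_right_comm] at this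

/-- Powers of an automorphism move the uniformizer at least as far. -/
theorem IsFullyRamifiedValuation.le_val_pow_sub (k : ℕ) :
    ((b + 1 : ℤ) : WithTop ℤ) ≤ v ((σ ^ k) π - π) := by
  induction k with
  | zero => simp
  | succ k ih =>
    have : (σ ^ (k + 1)) π - π = (σ ^ k) (σ π - π) + ((σ ^ k) π - π) := by
      rw [pow_succ, AlgEquiv.mul_apply, map_sub]
      ring
    rw [this]
    refine v.map_le_add ?_ ih
    rw [hv.val_algEquiv hπ, hb]

end Ramification

section Binom

variable {F : Type*} [Field F]

@[simp] theorem binom_zero (y : F) : binom y 0 = 1 := by simp [binom]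

theorem map_binom {F' : Type*} [Field F'] (f : F →+* F') (y : F) (i : ℕ) :
    f (binom y i) = binom (f y) i := by
  simp [binom, map_prod]

theorem natCast_ne_zero_of_lt (p : ℕ) [CharP F p] {i : ℕ} (h0 : 0 < i) (h : i < p) :
    (i : F) ≠ 0 := by
  rw [Ne, CharP.cast_eq_zero_iff F p]
  exact Nat.not_dvd_of_pos_of_lt h0 h

theorem factorial_ne_zero_of_lt (p : ℕ) [hp : Fact p.Prime] [CharP F p] {i : ℕ} (h : i < p) :
    (i.factorial : F) ≠ 0 := by
  rw [Ne, CharP.cast_eq_zero_iff F p, hp.out.dvd_factorial]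
  omega

theorem succ_mul_binom_succ (p : ℕ) [CharP F p] (y : F) {i : ℕ} (hi : i + 1 < p) :
    ((i + 1 : ℕ) : F) * binom y (i + 1) = (y - i) * binom y i := by
  have h1 : ((i + 1 : ℕ) : F) ≠ 0 := natCast_ne_zero_of_lt p (by omega) hi
  rw [binom, binom, Finset.prod_range_succ, Nat.factorial_succ, Nat.cast_mul]
  rw [mul_div_assoc', mul_div_mul_left _ _ h1]
  ring

/-- The Chu-Vandermonde identity below the characteristic. -/
theorem binom_add (p : ℕ) [CharP F p] (x y : F) {i : ℕ} (hi : i < p) :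
    binom (x + y) i = ∑ k ∈ Finset.range (i + 1), binom x (i - k) * binom y k := by
  induction i with
  | zero => simp
  | succ i ih =>
    have h1 : ((i + 1 : ℕ) : F) ≠ 0 := natCast_ne_zero_of_lt p (by omega) hi
    apply mul_left_cancel₀ h1
    rw [succ_mul_binom_succ p _ hi, ih (by omega), Finset.mul_sum, Finset.mul_sum]
    have h2 : ∀ k ∈ Finset.range (i + 1), (x + y - i) * (binom x (i - k) * binom y k) =
        ((i + 1 - k : ℕ) : F) * (binom x (i + 1 - k) * binom y k) +
          ((k + 1 : ℕ) : F) * (binom x (i + 1 - (k + 1)) * binom y (k + 1)) := by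
      intro k hk
      have hk' : k ≤ i := by simpa [Nat.lt_succ_iff] using hk
      have e1 := succ_mul_binom_succ p x (i := i - k) (by omega)
      have e2 := succ_mul_binom_succ p y (i := k) (by omega)
      rw [show i + 1 - k = i - k + 1 by omega, show i + 1 - (k + 1) = i - k by omega]
      have e3 : ((i - k : ℕ) : F) = i - k := by rw [Nat.cast_sub hk']
      rw [e3] at e1
      linear_combination (-binom y k) * e1 - binom x (i - k) * e2
    rw [Finset.sum_congr rfl h2, Finset.sum_add_distrib, Finset.sum_range_succ' _ (i + 1)]
    rw [Finset.sum_range_succ' (fun k => ((i + 1 - k : ℕ) : F) * (binom x (i + 1 - k) * binom y k))]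
    have h3 : ∑ k ∈ Finset.range (i + 1),
        ((k + 1 : ℕ) : F) * (binom x (i + 1 - (k + 1)) * binom y (k + 1)) =
        ∑ k ∈ Finset.range i,
          ((k + 1 : ℕ) : F) * (binom x (i + 1 - (k + 1)) * binom y (k + 1)) +
        ((i + 1 : ℕ) : F) * (binom x (i + 1 - (i + 1)) * binom y (i + 1)) :=
      Finset.sum_range_succ _ _
    rw [h3, Finset.sum_range_succ (fun k =>
      ((i + 1 : ℕ) : F) * (binom x (i + 1 - (k + 1)) * binom y (k + 1)))]
    have h4 : ∑ k ∈ Finset.range i,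
        ((i + 1 : ℕ) : F) * (binom x (i + 1 - (k + 1)) * binom y (k + 1)) =
        ∑ k ∈ Finset.range i,
          ((i + 1 - (k + 1) : ℕ) : F) * (binom x (i + 1 - (k + 1)) * binom y (k + 1)) +
        ∑ k ∈ Finset.range i,
          ((k + 1 : ℕ) : F) * (binom x (i + 1 - (k + 1)) * binom y (k + 1)) := by
      rw [← Finset.sum_add_distrib]
      refine Finset.sum_congr rfl fun k hk => ?_
      rw [← add_mul, ← Nat.cast_add]
      have e : i + 1 - (k + 1) + (k + 1) = i + 1 := by
        have := Finset.mem_range.1 hk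
        omega
      rw [e]
    rw [h4]
    simp only [Nat.sub_zero]
    ring

theorem binom_add_one (p : ℕ) [CharP F p] (y : F) {i : ℕ} (hi : i + 1 < p) :
    binom (y + 1) (i + 1) = binom y (i + 1) + binom y i := by
  have h1 : ((i + 1 : ℕ) : F) ≠ 0 := natCast_ne_zero_of_lt p (by omega) hi
  apply mul_left_cancel₀ h1
  rw [mul_add, succ_mul_binom_succ p y hi]
  rw [binom, Finset.prod_range_succ', Nat.factorial_succ, Nat.cast_mul, mul_div_assoc',
    mul_div_mul_left _ _ h1, binom]
  have : ∀ k : ℕ, y + 1 - ((k + 1 : ℕ) : F) = y - k := fun k => by push_cast; ring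
  simp only [this]
  push_cast
  ring

end Binom

section Witt

theorem map_wittPoly {R S : Type*} [CommRing R] [CommRing S] (f : R →+* S) (p : ℕ) (x y : R) :
    f (wittPoly p x y) = wittPoly p (f x) (f y) := by
  simp [wittPoly, map_sum]

theorem mul_wittPoly {R : Type*} [CommRing R] {p : ℕ} (hp : p.Prime) (x y : R) :
    (p : R) * wittPoly p x y = x ^ p + y ^ p - (x + y) ^ p := by
  have h : (x + y) ^ p = y ^ p + (∑ i ∈ Finset.Ico 1 p, x ^ i * y ^ (p - i) * (p.choose i : R)) +
      x ^ p := by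
    rw [add_pow, Finset.sum_range_succ, Finset.range_eq_Ico,
      Finset.sum_eq_sum_Ico_succ_bot hp.pos]
    simp
  rw [h, wittPoly, mul_neg, Finset.mul_sum]
  have : ∀ i ∈ Finset.Ico 1 p, (p : R) * (((p.choose i / p : ℕ) : R) * x ^ i * y ^ (p - i)) =
      x ^ i * y ^ (p - i) * (p.choose i : R) := by
    intro i hi
    rw [Finset.mem_Ico] at hi
    have h2 : p ∣ p.choose i := hp.dvd_choose_self (by omega) hi.2
    have h3 : (p : R) * ((p.choose i / p : ℕ) : R) = (p.choose i : R) := by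
      rw [← Nat.cast_mul, Nat.mul_div_cancel' h2]
    rw [← h3]
    ring
  rw [Finset.sum_congr rfl this]
  ring

/-- In the ring of Witt vectors, `p • (1, 0) = (0, 1)`. -/
theorem sum_wittPoly_add_one {R : Type*} [CommRing R] {p : ℕ} [hp : Fact p.Prime] [CharP R p]
    (x : R) : ∑ i ∈ Finset.range p, wittPoly p (x + i) 1 = 1 := by
  open Polynomial in
  have h : ∃ Q : ℤ[X], ∑ i ∈ Finset.range p, wittPoly p ((X : ℤ[X]) + (i : ℤ[X])) 1 =
      1 - (p : ℤ[X]) * Q := by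
    obtain ⟨Q, hQ⟩ := dvd_sub_pow_of_dvd_sub (p := p) (a := (X : ℤ[X]) + (p : ℤ[X])) (b := X)
      (by simp) 1
    refine ⟨Q, ?_⟩
    have hp0 : (p : ℤ[X]) ≠ 0 := by exact_mod_cast hp.out.ne_zero
    apply mul_left_cancel₀ hp0
    rw [Finset.mul_sum]
    simp_rw [mul_wittPoly hp.out]
    have h1 : ∀ i : ℕ, ((X : ℤ[X]) + (i : ℤ[X])) ^ p + 1 ^ p - ((X : ℤ[X]) + (i : ℤ[X]) + 1) ^ p =
        1 - (((X : ℤ[X]) + ((i + 1 : ℕ) : ℤ[X])) ^ p - ((X : ℤ[X]) + (i : ℤ[X])) ^ p) := by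
      intro i
      push_cast
      ring
    simp_rw [h1]
    rw [Finset.sum_sub_distrib, Finset.sum_range_sub (fun i : ℕ => ((X : ℤ[X]) + (i : ℤ[X])) ^ p)]
    simp only [Finset.sum_const, Finset.card_range, nsmul_eq_mul, mul_one, Nat.cast_zero, add_zero]
    rw [pow_one] at hQ
    rw [hQ]
    ring
  obtain ⟨Q, hQ⟩ := h
  have := congrArg (Polynomial.aeval x : Polynomial ℤ →ₐ[ℤ] R).toRingHom hQ
  rw [map_sum] at this
  simp only [map_wittPoly] at this
  simpa using this

end Witt

section Automorphisms

variable {K L : Type*} [Field K] [Field L] [Algebra K L] {σ : L ≃ₐ[K] L} {x y : L}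

theorem pow_apply_eq_add_natCast (hx : σ x - x = 1) (k : ℕ) : (σ ^ k) x = x + k := by
  induction k with
  | zero => simp
  | succ k ih =>
    rw [pow_succ', AlgEquiv.mul_apply, ih, map_add, map_natCast, sub_eq_iff_eq_add.1 hx]
    push_cast
    ring

theorem pow_apply_eq_add_sum_wittPoly {p : ℕ} (hx : σ x - x = 1)
    (hy : σ y - y = wittPoly p x 1) (k : ℕ) :
    (σ ^ k) y = y + ∑ i ∈ Finset.range k, wittPoly p (x + i) 1 := by
  induction k with
  | zero => simp
  | succ k ih =>
    have h : (σ ^ k) (wittPoly p x 1) = wittPoly p (x + k) 1 := by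
      have := map_wittPoly ((σ ^ k : L ≃ₐ[K] L) : L →+* L) p x 1
      simpa [pow_apply_eq_add_natCast hx] using this
    rw [pow_succ, AlgEquiv.mul_apply, sub_eq_iff_eq_add.1 hy, map_add, ih, h,
      Finset.sum_range_succ]
    ring

variable {p : ℕ} [hp : Fact p.Prime] [CharP L p]

omit hp in
theorem pow_prime_apply_eq_self (hx : σ x - x = 1) : (σ ^ p) x = x := by
  rw [pow_apply_eq_add_natCast hx, CharP.cast_eq_zero, add_zero]

theorem pow_prime_apply_eq_add_one (hx : σ x - x = 1) (hy : σ y - y = wittPoly p x 1) :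
    (σ ^ p) y = y + 1 := by
  rw [pow_apply_eq_add_sum_wittPoly hx hy, sum_wittPoly_add_one]

omit hp in
theorem apply_binom_succ (hx : σ x - x = 1) {j : ℕ} (hj : j + 1 < p) :
    σ (binom x (j + 1)) = binom x (j + 1) + binom x j := by
  have := map_binom ((σ : L ≃ₐ[K] L) : L →+* L) x (j + 1)
  simp only [RingHom.coe_coe] at this
  rw [this, sub_eq_iff_eq_add.1 hx, add_comm 1 x, binom_add_one p x hj]

/-- The operator `σ - 1`. -/
def delta (σ : L ≃ₐ[K] L) : Module.End K L := DistribMulAction.toModuleEnd K L σ - 1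

omit hp [CharP L p] in
theorem delta_apply (σ : L ≃ₐ[K] L) (z : L) : delta σ z = σ z - z := rfl

omit hp in
theorem delta_pow_binom (hx : σ x - x = 1) (k : ℕ) {j : ℕ} (hj : k + j < p) :
    (delta σ ^ k) (binom x (k + j)) = binom x j := by
  induction k with
  | zero => simp
  | succ k ih =>
    rw [pow_succ, Module.End.mul_apply, delta_apply, show k + 1 + j = (k + j) + 1 by ring,
      apply_binom_succ (p := p) hx (by omega), add_sub_cancel_left, ih (by omega)]

theorem delta_pow_prime (σ : L ≃ₐ[K] L) (z : L) : (delta σ ^ p) z = (σ ^ p) z - z := by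
  have : CharP K p := (algebraMap K L).charP (algebraMap K L).injective p
  have : CharP (Module.End K L) p := charP_of_injective_algebraMap
    (FaithfulSMul.algebraMap_injective K (Module.End K L)) p
  rw [delta, sub_pow_expChar_of_commute p (Commute.one_right _), one_pow, ← map_pow]
  rfl

omit hp in
/-- An element killed by `(σ - 1) ^ m`, `m ≤ p`, is a combination of `binom x j`, `j < m`. -/
theorem exists_sum_binom_of_delta_pow_eq_zero [FiniteDimensional K L] [IsGalois K L]
    (hσ : ∀ τ : L ≃ₐ[K] L, τ ∈ Subgroup.zpowers σ) (hx : σ x - x = 1) {m : ℕ} (hm : m ≤ p)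
    {z : L} (hz : (delta σ ^ m) z = 0) :
    ∃ c : ℕ → K, z = ∑ j ∈ Finset.range m, c j • binom x j := by
  induction m generalizing z with
  | zero => exact ⟨0, by simpa using hz⟩
  | succ m ih =>
    have h1 : σ ((delta σ ^ m) z) = (delta σ ^ m) z := by
      rw [pow_succ', Module.End.mul_apply, delta_apply] at hz
      exact sub_eq_zero.1 hz
    have h2 : (delta σ ^ m) z ∈ Set.range (algebraMap K L) := by
      rw [IsGalois.mem_range_algebraMap_iff_fixed]
      intro τ
      obtain ⟨k, rfl⟩ := Subgroup.mem_zpowers_iff.1 (hσ τ)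
      have : (σ ^ k) • ((delta σ ^ m) z) = (delta σ ^ m) z := by
        have : σ ∈ MulAction.stabilizer (L ≃ₐ[K] L) ((delta σ ^ m) z) := h1
        exact Subgroup.zpow_mem _ this k
      exact this
    obtain ⟨a, ha⟩ := h2
    obtain ⟨c, hc⟩ := ih (by omega) (z := z - a • binom x m) (by
      have := delta_pow_binom (p := p) hx m (j := 0) (by omega)
      rw [map_sub, map_smul]
      simp only [add_zero, binom_zero] at this
      rw [this, ← ha, Algebra.algebraMap_eq_smul_one, sub_self])
    refine ⟨Function.update c m a, ?_⟩
    rw [Finset.sum_range_succ, Function.update_self]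
    have : ∑ j ∈ Finset.range m, Function.update c m a j • binom x j =
        ∑ j ∈ Finset.range m, c j • binom x j := by
      refine Finset.sum_congr rfl fun j hj => ?_
      rw [Function.update_of_ne (Finset.mem_range.1 hj).ne]
    rw [this, ← hc]
    ring

end Automorphisms

section Arithmetic

variable {p : ℕ} [hp : Fact p.Prime] {κ : Type*} [Field κ] [CharP κ p]
  {L : Type*} [Field L] [Algebra κ⸨X⸩ L] {v : AddValuation L (WithTop ℤ)}
  (hv : IsFullyRamifiedValuation κ v)

include hp

omit hp in
theorem charP_of_algebra_laurentSeries (p : ℕ) (κ : Type*) [Field κ] [CharP κ p]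
    (L : Type*) [Field L] [Algebra κ⸨X⸩ L] : CharP L p :=
  charP_of_injective_ringHom
    ((algebraMap κ⸨X⸩ L).comp (HahnSeries.C : κ →+* κ⸨X⸩)).injective p

omit [CharP κ p] in
theorem val_eq_of_val_pow_sub {x : L} {k : ℤ} (hk : k < 0)
    (h : v (x ^ p - x) = ((p * k : ℤ) : WithTop ℤ)) : v x = k := by
  have hp1 : (1 : ℤ) < p := by exact_mod_cast hp.out.one_lt
  have hx : x ≠ 0 := by
    rintro rfl
    rw [zero_pow hp.out.ne_zero, sub_zero, v.map_zero] at h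
    exact WithTop.coe_ne_top h.symm
  obtain ⟨l, hl⟩ := exists_val_eq v hx
  have hl0 : l < 0 := by
    by_contra hl0
    have h1 : ((0 : ℤ) : WithTop ℤ) ≤ v x := by rw [hl]; exact_mod_cast not_lt.1 hl0
    have h2 : ((0 : ℤ) : WithTop ℤ) ≤ v (x ^ p - x) :=
      v.map_le_sub (by simpa using le_val_pow h1 p) h1
    rw [h] at h2
    have : (0 : ℤ) ≤ p * k := by exact_mod_cast h2
    nlinarith
  have h3 := val_sub_eq (y := x) (val_pow_eq hl p) (by
    rw [hl]
    have : (p * l + 1 : ℤ) ≤ l := by nlinarith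
    exact_mod_cast this)
  rw [h] at h3
  have h4 : (p * k : ℤ) = p * l := by exact_mod_cast h3
  rw [hl, mul_left_cancel₀ (by omega) h4]

include hv

theorem IsFullyRamifiedValuation.val_factorial {i : ℕ} (hi : i < p) :
    v (i.factorial : L) = 0 :=
  hv.val_natCast (p := p) (by rw [hp.out.dvd_factorial]; omega)

theorem IsFullyRamifiedValuation.val_binom_eq_val_prod {i : ℕ} (hi : i < p) (x : L) :
    v (binom x i) = v (∏ k ∈ Finset.range i, (x - k)) := by
  have : CharP L p := charP_of_algebra_laurentSeries p κ L
  have h : ∏ k ∈ Finset.range i, (x - k) = binom x i * (i.factorial : L) := by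
    rw [binom, div_mul_cancel₀ _ (factorial_ne_zero_of_lt p hi)]
  rw [h, v.map_mul, hv.val_factorial hi, add_zero]

theorem IsFullyRamifiedValuation.val_binom {x : L} {a : ℤ} (hx : v x = ((-a : ℤ) : WithTop ℤ))
    (ha : 0 < a) {i : ℕ} (hi : i < p) : v (binom x i) = ((-(i * a) : ℤ) : WithTop ℤ) := by
  rw [hv.val_binom_eq_val_prod hi,
    val_prod_eq (a := fun _ => -a) fun k _ => GaloisScaffold.val_sub_eq hx ?_]
  · simp
  · refine le_trans ?_ (val_natCast_nonneg k)
    exact_mod_cast (by omega : -a + 1 ≤ 0)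

theorem IsFullyRamifiedValuation.le_val_binom {x : L} {a : ℤ}
    (hx : ((-a : ℤ) : WithTop ℤ) ≤ v x)
    (ha : 0 ≤ a) {i : ℕ} (hi : i < p) : ((-(i * a) : ℤ) : WithTop ℤ) ≤ v (binom x i) := by
  rw [hv.val_binom_eq_val_prod hi]
  have := le_val_prod (v := v) (s := Finset.range i) (f := fun k : ℕ => x - (k : L))
    (a := fun _ => -a) fun k _ => v.map_le_sub hx (le_trans ?_ (val_natCast_nonneg k))
  · simpa using this
  · exact_mod_cast (by omega : -a ≤ 0)

variable [FiniteDimensional κ⸨X⸩ L] {π : L} (hπ : v π = 1) {σ : L ≃ₐ[κ⸨X⸩] L} {x : L}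
  (hσx : σ x - x = 1)

include hπ hσx

omit hp [CharP κ p] in
theorem IsFullyRamifiedValuation.val_neg_of_sub_eq_one : v x < 0 := by
  by_contra h
  obtain ⟨c, hc⟩ := hv.exists_residue hπ (not_lt.1 h)
  have h1 := hv.val_algEquiv hπ σ (x - algebraMap κ⸨X⸩ L (HahnSeries.C c))
  rw [map_sub, AlgEquiv.commutes, sub_eq_iff_eq_add.1 hσx] at h1
  rw [← h1] at hc
  have h2 := v.map_le_sub hc (h1 ▸ hc)
  rw [show (1 + x - algebraMap κ⸨X⸩ L (HahnSeries.C c)) - (x - algebraMap κ⸨X⸩ L (HahnSeries.C c))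
    = 1 by ring, v.map_one] at h2
  exact absurd h2 (by norm_num)

theorem IsFullyRamifiedValuation.exists_val_artinSchreier [PerfectField κ]
    (hdeg : Module.finrank κ⸨X⸩ L = p ^ 2) {β : κ⸨X⸩}
    (hβ : ∀ c : κ⸨X⸩, (β + (c ^ p - c)).orderTop ≤ β.orderTop)
    (hx : x ^ p - x = algebraMap κ⸨X⸩ L β) :
    ∃ u : ℤ, 0 < u ∧ ¬ (p : ℤ) ∣ u ∧ β.orderTop = ((-u : ℤ) : WithTop ℤ) ∧
      v x = ((-(p * u) : ℤ) : WithTop ℤ) := by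
  have hp1 : (1 : ℤ) < p := by exact_mod_cast hp.out.one_lt
  have hxneg := hv.val_neg_of_sub_eq_one hπ hσx
  have hx0 : x ≠ 0 := by
    rintro rfl
    simp at hxneg
  obtain ⟨l, hl⟩ := exists_val_eq v hx0
  have hl0 : l < 0 := by
    rw [hl] at hxneg
    exact_mod_cast hxneg
  have h3 := GaloisScaffold.val_sub_eq (y := x) (val_pow_eq hl p) (by
    rw [hl]
    have : (p * l + 1 : ℤ) ≤ l := by nlinarith
    exact_mod_cast this)
  rw [hx] at h3
  have hβ0 : β ≠ 0 := by
    rintro rfl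
    rw [map_zero, v.map_zero] at h3
    exact WithTop.coe_ne_top h3.symm
  obtain ⟨k, hk, hk'⟩ := hv.exists_val_algebraMap hβ0
  rw [h3, hdeg] at hk'
  have h4 : l = p * k := by
    have : (p * l : ℤ) = (p ^ 2 : ℕ) * k := by exact_mod_cast hk'
    push_cast at this
    exact mul_left_cancel₀ (by omega : (p : ℤ) ≠ 0) (by linarith)
  have hk0 : k < 0 := by nlinarith
  refine ⟨-k, by omega, ?_, by simpa using hk, by rw [hl, h4]; simp⟩
  rintro ⟨k', hkk⟩
  obtain ⟨r, hr⟩ := surjective_frobenius κ p (-(β.coeff k))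
  rw [frobenius_def] at hr
  have h5 := hβ (HahnSeries.single (-k') r)
  rw [hk, HahnSeries.single_pow, hr, nsmul_eq_mul, show (p : ℤ) * -k' = k by linarith] at h5
  have hkk' : k < -k' := by nlinarith
  obtain ⟨m, hm⟩ := WithTop.ne_top_iff_exists.1 (ne_top_of_le_ne_top WithTop.coe_ne_top h5)
  have h6 := HahnSeries.coeff_orderTop_ne hm.symm
  rw [← hm] at h5
  have hmk : m ≤ k := by exact_mod_cast h5
  apply h6
  rw [HahnSeries.coeff_add, HahnSeries.coeff_sub,
    HahnSeries.coeff_single_of_ne (a := -k') (by omega)]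
  rcases eq_or_lt_of_le hmk with rfl | hlt
  · simp
  · rw [HahnSeries.coeff_single_of_ne (by omega), HahnSeries.coeff_eq_zero_of_lt_orderTop]
    · simp
    · rw [hk]
      exact_mod_cast hlt

variable [IsGalois κ⸨X⸩ L] (hdeg : Module.finrank κ⸨X⸩ L = p ^ 2)
  (hσ : ∀ τ : L ≃ₐ[κ⸨X⸩] L, τ ∈ Subgroup.zpowers σ)

include hdeg hσ

omit hπ in
theorem IsFullyRamifiedValuation.le_val_sub_of_fixed {u : ℤ} (hu : 0 < u) (hpu : ¬ (p : ℤ) ∣ u)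
    (hvx : v x = ((-(p * u) : ℤ) : WithTop ℤ)) {z : L} (hz : (σ ^ p) z = z) (hz0 : 0 ≤ v z) :
    ((p * (u + 1) : ℤ) : WithTop ℤ) ≤ v (σ z - z) := by
  have hp1 : (1 : ℤ) < p := by exact_mod_cast hp.out.one_lt
  have hpu0 : 0 < p * u := by positivity
  have : CharP L p := charP_of_algebra_laurentSeries p κ L
  obtain ⟨c, hc⟩ := exists_sum_binom_of_delta_pow_eq_zero (p := p) hσ hσx le_rfl (z := z)
    (by rw [delta_pow_prime, hz, sub_self])
  rw [Finset.sum_range] at hc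
  have hy : ∀ i : Fin p, v (binom x (i : ℕ)) = ((-((i : ℕ) * (p * u)) : ℤ) : WithTop ℤ) :=
    fun i => hv.val_binom hvx hpu0 i.2
  have h := (hv.le_val_sum_iff hy (fun i j hij => by
    rw [hdeg] at hij
    apply fin_eq_of_dvd_sub
    have h1 : (p : ℤ) * p ∣ p * (u * ((j : ℕ) - (i : ℕ))) := by
      have : ((p ^ 2 : ℕ) : ℤ) = p * p := by push_cast; ring
      rw [this] at hij
      convert hij using 1
      ring
    have h2 := (mul_dvd_mul_iff_left (by omega : (p : ℤ) ≠ 0)).1 h1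
    have h3 := ((Nat.prime_iff_prime_int.1 hp.out).dvd_or_dvd h2).resolve_left hpu
    rwa [← dvd_neg, neg_sub] at h3) (fun i => c i) 0).1 (by rw [← hc]; exact hz0)
  have h1 : σ z - z = ∑ i : Fin p, c i • (σ (binom x (i : ℕ)) - binom x (i : ℕ)) := by
    simp only [smul_sub, Finset.sum_sub_distrib]
    rw [← hc]
    conv_lhs => rw [hc, map_sum]
    simp only [map_smul σ]
    rw [← hc]
  rw [h1]
  refine v.map_le_sum fun i _ => ?_
  obtain ⟨i, hi⟩ := i
  rcases i with _ | i
  · simp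
  simp only
  rw [apply_binom_succ (p := p) hσx hi, add_sub_cancel_left]
  by_cases h0 : c (i + 1) = 0
  · simp [h0]
  have h2 := h ⟨i + 1, hi⟩
  simp only at h2
  obtain ⟨k, -, hk⟩ := hv.exists_val_smul h0 (hy ⟨i + 1, hi⟩)
  obtain ⟨k', hk1, hk2⟩ := hv.exists_val_smul h0 (hy ⟨i, by omega⟩)
  obtain ⟨k, hk3, hk⟩ := hv.exists_val_smul h0 (hy ⟨i + 1, hi⟩)
  have hkk : k' = k := by
    rw [hk1] at hk3
    exact_mod_cast hk3
  subst hkk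
  simp only at hk hk2
  rw [hk] at h2
  rw [hk2]
  rw [hdeg] at h2 ⊢
  have h3 : (0 : ℤ) ≤ (p ^ 2 : ℕ) * k' + -(((i + 1 : ℕ) : ℤ) * (p * u)) := by exact_mod_cast h2
  push_cast at h3
  have h4 : (0 : ℤ) ≤ p * (p * k' - (i + 1) * u) := by linarith
  have h5 : (0 : ℤ) ≤ p * k' - (i + 1) * u := nonneg_of_mul_nonneg_right h4 (by omega)
  have h6 : (p * k' - (i + 1) * u : ℤ) ≠ 0 := by
    intro h6
    have h7 : (p : ℤ) ∣ ((i + 1 : ℕ) : ℤ) * u := ⟨k', by push_cast; linarith⟩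
    rcases (Nat.prime_iff_prime_int.1 hp.out).dvd_or_dvd h7 with h8 | h8
    · exact Nat.not_dvd_of_pos_of_lt (Nat.succ_pos i) hi (by exact_mod_cast h8)
    · exact hpu h8
  have h7 : (1 : ℤ) ≤ p * k' - (i + 1) * u := by omega
  have h8 : (p * (u + 1) : ℤ) ≤ (p ^ 2 : ℕ) * k' + -((i : ℤ) * (p * u)) := by
    push_cast
    nlinarith
  exact_mod_cast h8

/-- The first lower ramification number is at least the ramification number of the quotient. -/
theorem IsFullyRamifiedValuation.le_ramificationNumber {u b : ℤ} (hu : 0 < u)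
    (hpu : ¬ (p : ℤ) ∣ u) (hvx : v x = ((-(p * u) : ℤ) : WithTop ℤ))
    (hb : v (σ π - π) = ((b + 1 : ℤ) : WithTop ℤ)) : u ≤ b := by
  classical
  have hp0 : (0 : ℤ) < p := by exact_mod_cast hp.out.pos
  have hord : σ ^ (p ^ 2) = 1 := by
    rw [← hdeg, ← IsGalois.card_aut_eq_finrank κ⸨X⸩ L]
    exact pow_card_eq_one'
  have hπσ : σ π ≠ π := by
    intro h
    rw [h, sub_self, v.map_zero] at hb
    exact WithTop.coe_ne_top hb.symm
  have hconj : ∀ i : ℕ, ∃ a : ℤ, a ≤ b + 1 ∧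
      v (π - (σ ^ (1 + p * i)) π) = (a : WithTop ℤ) := by
    intro i
    have hcop : (1 + p * i).Coprime (orderOf σ) := by
      refine Nat.Coprime.coprime_dvd_right (orderOf_dvd_of_pow_eq_one hord) ?_
      apply Nat.Coprime.pow_right
      simp
    obtain ⟨m, hm⟩ := exists_pow_eq_self_of_coprime hcop
    have hne : π - (σ ^ (1 + p * i)) π ≠ 0 := by
      intro h
      apply hπσ
      rw [← hm]
      have : σ ^ (1 + p * i) ∈ MulAction.stabilizer (L ≃ₐ[κ⸨X⸩] L) π := (sub_eq_zero.1 h).symm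
      exact Subgroup.pow_mem _ this m
    obtain ⟨a, ha⟩ := exists_val_eq v hne
    refine ⟨a, ?_, ha⟩
    have h1 := hv.le_val_pow_sub hπ (σ := σ ^ (1 + p * i)) (b := a - 1)
      (by rw [v.map_sub_swap, ha, sub_add_cancel]) m
    rw [hm, hb] at h1
    have : a - 1 + 1 ≤ b + 1 := by exact_mod_cast h1
    omega
  choose a ha ha' using hconj
  let f : Polynomial L :=
    ∏ i ∈ Finset.range p, (Polynomial.X - Polynomial.C ((σ ^ (p * i)) π))
  have hfcoeff : ∀ k, 0 ≤ v (f.coeff k) := by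
    intro k
    let g : Polynomial (valRing v) := ∏ i ∈ Finset.range p,
      (Polynomial.X - Polynomial.C ⟨(σ ^ (p * i)) π, by
        change 0 ≤ v _
        rw [hv.val_algEquiv hπ, hπ]
        norm_num⟩)
    have hg : g.map (valRing v).subtype = f := by
      simp [g, f, Polynomial.map_prod]
    rw [← hg, Polynomial.coeff_map]
    exact (g.coeff k).2
  have hffix : f.map ((σ ^ p : L ≃ₐ[κ⸨X⸩] L) : L →+* L) = f := by
    simp only [f, Polynomial.map_prod, Polynomial.map_sub, Polynomial.map_X, Polynomial.map_C]
    have h1 : ∀ i : ℕ, ((σ ^ p : L ≃ₐ[κ⸨X⸩] L) : L →+* L) ((σ ^ (p * i)) π) =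
        (σ ^ (p * (i + 1))) π := by
      intro i
      rw [RingHom.coe_coe, ← AlgEquiv.mul_apply, ← pow_add]
      congr 2
      ring
    simp only [h1]
    have h2 := Finset.prod_range_succ
      (fun i => Polynomial.X - Polynomial.C ((σ ^ (p * i)) π)) p
    rw [Finset.prod_range_succ', mul_zero, pow_zero, ← pow_two, hord] at h2
    exact mul_right_cancel₀ (Polynomial.X_sub_C_ne_zero _) h2
  have hfcoeff' : ∀ k, (σ ^ p) (f.coeff k) = f.coeff k := by
    intro k
    conv_rhs => rw [← hffix, Polynomial.coeff_map]
    rfl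
  have heval0 : f.eval π = 0 := by
    simp only [f, Polynomial.eval_prod]
    exact Finset.prod_eq_zero (Finset.mem_range.2 hp.out.pos) (by simp)
  have heval1 : (f.map (σ : L →+* L)).eval π =
      ∏ i ∈ Finset.range p, (π - (σ ^ (1 + p * i)) π) := by
    simp only [f, Polynomial.map_prod, Polynomial.map_sub, Polynomial.map_X, Polynomial.map_C,
      Polynomial.eval_prod, Polynomial.eval_sub, Polynomial.eval_X, Polynomial.eval_C]
    refine Finset.prod_congr rfl fun i _ => ?_
    rw [RingHom.coe_coe, ← AlgEquiv.mul_apply, pow_add, pow_one]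
  have hle : ((p * (u + 1) : ℤ) : WithTop ℤ) ≤ v ((f.map (σ : L →+* L)).eval π) := by
    have h1 : (f.map (σ : L →+* L)).eval π = (f.map (σ : L →+* L) - f).eval π := by
      rw [Polynomial.eval_sub, heval0, sub_zero]
    rw [h1, Polynomial.eval_eq_sum_range]
    refine v.map_le_sum fun k _ => ?_
    rw [Polynomial.coeff_sub, Polynomial.coeff_map, RingHom.coe_coe]
    have h2 := le_val_mul (hv.le_val_sub_of_fixed hσx hdeg hσ hu hpu hvx (hfcoeff' k)
      (hfcoeff k)) (val_uniformizer_pow hπ k).ge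
    refine le_trans ?_ h2
    have : (p * (u + 1) : ℤ) ≤ p * (u + 1) + (k : ℤ) := by omega
    exact_mod_cast this
  rw [heval1, val_prod_eq fun i _ => ha' i] at hle
  have h1 : (p * (u + 1) : ℤ) ≤ ∑ i ∈ Finset.range p, a i := by exact_mod_cast hle
  have h2 : ∑ i ∈ Finset.range p, a i ≤ p * (b + 1) := by
    have := Finset.sum_le_card_nsmul (Finset.range p) a (b + 1) fun i _ => ha i
    simpa using this
  have h3 : u + 1 ≤ b + 1 := le_of_mul_le_mul_left (h1.trans h2) hp0
  omega

end Arithmetic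

/-- Generators `x, y` adapted to the filtration of a cyclic extension of degree `p²`, with the
action of `σ₁` and `σ₂` on them, and their values. -/
structure AdaptedGenerators (p : ℕ) {K L : Type*} [Field K] [Field L] [Algebra K L]
    (v : AddValuation L (WithTop ℤ)) (σ₁ σ₂ : L ≃ₐ[K] L) (μ : K) (b₁ b₂ : ℤ) (x y w : L) :
    Prop where
  apply₁_x : σ₁ x = x + 1
  apply₂_x : σ₂ x = x
  apply₁_y : σ₁ y = y + w - algebraMap K L μ
  apply₂_y : σ₂ y = y + 1
  val_x : v x = ((-(p * b₁) : ℤ) : WithTop ℤ)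
  val_y : v y = ((-b₂ : ℤ) : WithTop ℤ)
  le_val_w : ((-((p - 1) * (p * b₁)) : ℤ) : WithTop ℤ) ≤ v w
  pos : 0 < b₁
  not_dvd : ¬ (p : ℤ) ∣ b₁
  lt : p ^ 2 * b₁ < b₂
  dvd_sub : (p : ℤ) ^ 2 ∣ b₂ - b₁

theorem le_val_wittPoly {L : Type*} [Field L] {v : AddValuation L (WithTop ℤ)} {p : ℕ} {x y : L}
    {a c k : ℤ} (hx : (a : WithTop ℤ) ≤ v x) (hy : (c : WithTop ℤ) ≤ v y)
    (h : ∀ i : ℤ, 1 ≤ i → i + 1 ≤ p → k ≤ i * a + (p - i) * c) :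
    (k : WithTop ℤ) ≤ v (wittPoly p x y) := by
  rw [wittPoly, v.map_neg]
  refine v.map_le_sum fun i hi => ?_
  rw [Finset.mem_Ico] at hi
  have h0 : ((0 : ℤ) : WithTop ℤ) ≤ v ((p.choose i / p : ℕ) : L) := val_natCast_nonneg _
  have h1 := le_val_mul (le_val_mul h0 (le_val_pow hx i)) (le_val_pow hy (p - i))
  refine le_trans ?_ h1
  have := h i (by omega) (by omega)
  rw [Nat.cast_sub hi.2.le, zero_add]
  exact_mod_cast this

section

variable {p : ℕ} [hp : Fact p.Prime] {κ : Type*} [Field κ] [CharP κ p]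
  {L : Type*} [Field L] [Algebra κ⸨X⸩ L] {v : AddValuation L (WithTop ℤ)}
  (hv : IsFullyRamifiedValuation κ v) (hdeg : Module.finrank κ⸨X⸩ L = p ^ 2)

include hp hv hdeg

omit [CharP κ p] in
theorem IsFullyRamifiedValuation.exists_orderTop_mu {u b : ℤ} (hb : 0 ≤ b)
    {β₁ β₂ μ ε : κ⸨X⸩} (hβ₁ : β₁.orderTop = ((-u : ℤ) : WithTop ℤ)) (hμε : β₂ = μ ^ p * β₁ + ε)
    (hcond₁ : p • β₂.orderTop + ((((p : ℤ) - 1) * b : ℤ) : WithTop ℤ) < p • ε.orderTop)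
    (hcond₂ : p • β₂.orderTop + ((((p : ℤ) - 1) * b : ℤ) : WithTop ℤ) <
      p • (β₁ ^ p).orderTop) :
    ∃ m : ℤ, v (algebraMap κ⸨X⸩ L μ) = ((-(p ^ 2 * m) : ℤ) : WithTop ℤ) ∧
      p ^ 2 * u < p * (p * m + u) - (p - 1) * b ∧
      ((p * (-(p * (p * m + u)) + (p - 1) * b) + 1 : ℤ) : WithTop ℤ) ≤
        v (algebraMap κ⸨X⸩ L ε) := by
  have hp1 : (1 : ℤ) < p := by exact_mod_cast hp.out.one_lt
  have hpb : 0 ≤ ((p : ℤ) - 1) * b := mul_nonneg (by omega) hb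
  have htop : p • (⊤ : WithTop ℤ) = ⊤ := by
    obtain ⟨q, hq⟩ := Nat.exists_eq_succ_of_ne_zero hp.out.ne_zero
    rw [hq, succ_nsmul, add_top]
  have hβ₂0 : β₂ ≠ 0 := by
    rintro rfl
    rw [HahnSeries.orderTop_zero, htop, top_add] at hcond₂
    exact not_top_lt hcond₂
  have hβ₁0 : β₁ ≠ 0 := by
    rintro rfl
    rw [HahnSeries.orderTop_zero] at hβ₁
    exact WithTop.coe_ne_top hβ₁.symm
  obtain ⟨s, hs, hs'⟩ := hv.exists_val_algebraMap hβ₂0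
  obtain ⟨r, hr, hr'⟩ := hv.exists_val_algebraMap (pow_ne_zero p hβ₁0)
  have hvβ₁ := hv.val_algebraMap hβ₁
  rw [map_pow, val_pow_eq hvβ₁] at hr'
  rw [hdeg] at hs' hr' hvβ₁
  have hpp : ((p ^ 2 : ℕ) : ℤ) = (p : ℤ) ^ 2 := by push_cast; rfl
  rw [hpp] at hs' hr' hvβ₁
  have hr2 : (p : ℤ) ^ 2 * (p * -u) = p ^ 2 * r := by
    have h : (p : ℤ) * (p ^ 2 * -u) = p ^ 2 * r := WithTop.coe_injective hr'
    linarith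
  have hr3 : r = p * -u := (mul_left_cancel₀ (by positivity) hr2).symm
  have hc2 : p * s + (p - 1) * b < p * r := by
    rw [hs, hr, ← WithTop.coe_nsmul, ← WithTop.coe_nsmul, ← WithTop.coe_add,
      nsmul_eq_mul, nsmul_eq_mul] at hcond₂
    exact_mod_cast hcond₂
  have hε : ((p * (p * s + (p - 1) * b) + 1 : ℤ) : WithTop ℤ) ≤ v (algebraMap κ⸨X⸩ L ε) ∧
      ((p ^ 2 * s + 1 : ℤ) : WithTop ℤ) ≤ v (algebraMap κ⸨X⸩ L ε) := by
    by_cases h0 : ε = 0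
    · simp [h0]
    obtain ⟨f, hf, hf'⟩ := hv.exists_val_algebraMap h0
    rw [hdeg, hpp] at hf'
    rw [hs, hf, ← WithTop.coe_nsmul, ← WithTop.coe_nsmul, ← WithTop.coe_add,
      nsmul_eq_mul, nsmul_eq_mul] at hcond₁
    have h1 : p * s + (p - 1) * b < p * f := by exact_mod_cast hcond₁
    rw [hf']
    constructor
    · have : (p * (p * s + (p - 1) * b) + 1 : ℤ) ≤ p ^ 2 * f := by nlinarith
      exact_mod_cast this
    · have : (p ^ 2 * s + 1 : ℤ) ≤ p ^ 2 * f := by nlinarith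
      exact_mod_cast this
  have h1 := GaloisScaffold.val_sub_eq hs' hε.2
  rw [← map_sub, hμε, add_sub_cancel_right] at h1
  have hμ0 : μ ≠ 0 := by
    rintro rfl
    rw [zero_pow hp.out.ne_zero, zero_mul, map_zero, v.map_zero] at h1
    exact WithTop.coe_ne_top h1.symm
  obtain ⟨k, -, hk⟩ := hv.exists_val_algebraMap hμ0
  rw [hdeg, hpp] at hk
  rw [map_mul, map_pow, val_mul_eq (val_pow_eq hk p) hvβ₁] at h1
  have h2 : (p * (p ^ 2 * k) + p ^ 2 * -u : ℤ) = p ^ 2 * s := by exact_mod_cast h1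
  have h3 : s = p * k - u := by
    have : (p : ℤ) ^ 2 * s = p ^ 2 * (p * k - u) := by linarith
    exact mul_left_cancel₀ (by positivity) this
  refine ⟨-k, by rw [hk]; simp, ?_, ?_⟩
  · rw [hr3, h3] at hc2
    linarith
  · have := hε.1
    rw [h3] at this
    convert this using 3
    ring

variable [FiniteDimensional κ⸨X⸩ L] [IsGalois κ⸨X⸩ L] [PerfectField κ]
  {π : L} (hπ : v π = 1) {σ : L ≃ₐ[κ⸨X⸩] L}
  (hσ : ∀ τ : L ≃ₐ[κ⸨X⸩] L, τ ∈ Subgroup.zpowers σ) {b₁ b₂ : ℤ}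
  (hb₁ : v (σ π - π) = ((b₁ + 1 : ℤ) : WithTop ℤ))
  (hb₂ : v ((σ ^ p) π - π) = ((b₂ + 1 : ℤ) : WithTop ℤ))

include hπ hσ hb₁ hb₂

/-- The Artin-Schreier-Witt generators yield adapted generators. -/
theorem IsFullyRamifiedValuation.adaptedGenerators {β₁ β₂ μ ε : κ⸨X⸩}
    (hβ₁ : ∀ c : κ⸨X⸩, (β₁ + (c ^ p - c)).orderTop ≤ β₁.orderTop) {x₁ x₂ : L}
    (hx₁ : x₁ ^ p - x₁ = algebraMap κ⸨X⸩ L β₁)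
    (hx₂ : x₂ ^ p - x₂ =
      wittPoly p x₁ (algebraMap κ⸨X⸩ L β₁) + algebraMap κ⸨X⸩ L β₂)
    (hσx₁ : σ x₁ - x₁ = 1) (hσx₂ : σ x₂ - x₂ = wittPoly p x₁ 1)
    (hμε : β₂ = μ ^ p * β₁ + ε)
    (hcond₁ : p • β₂.orderTop + ((((p : ℤ) - 1) * b₁ : ℤ) : WithTop ℤ) < p • ε.orderTop)
    (hcond₂ : p • β₂.orderTop + ((((p : ℤ) - 1) * b₁ : ℤ) : WithTop ℤ) <
      p • (β₁ ^ p).orderTop) :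
    AdaptedGenerators p v σ (σ ^ p) μ b₁ b₂ x₁ (x₂ - algebraMap κ⸨X⸩ L μ * x₁)
      (wittPoly p x₁ 1) := by
  have hp1 : (1 : ℤ) < p := by exact_mod_cast hp.out.one_lt
  have : CharP L p := charP_of_algebra_laurentSeries p κ L
  obtain ⟨u, hu, hpu, hβu, hvx⟩ := hv.exists_val_artinSchreier hπ hσx₁ hdeg hβ₁ hx₁
  have hub : u ≤ b₁ := hv.le_ramificationNumber hπ hσx₁ hdeg hσ hu hpu hvx hb₁
  obtain ⟨m, hm, hm1, hε⟩ := hv.exists_orderTop_mu hdeg (by omega) hβu hμε hcond₁ hcond₂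
  have hvβ := hv.val_algebraMap hβu
  rw [hdeg] at hvβ
  push_cast at hvβ
  have hub' : (p - 1) * u ≤ (p - 1) * b₁ := by nlinarith
  have hpm : (p ^ 2 - 1) * u < p ^ 2 * m := by nlinarith
  have hpm' : (p - 1) * u < p * m := by nlinarith
  have hm0 : 0 < m := by nlinarith
  set M := algebraMap κ⸨X⸩ L μ with hM
  set y := x₂ - M * x₁ with hy
  have hwp : y ^ p - y = -((M ^ p - M) * x₁) +
      (wittPoly p x₁ (algebraMap κ⸨X⸩ L β₁) + algebraMap κ⸨X⸩ L ε) := by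
    rw [hy, sub_pow_char, mul_pow]
    rw [hμε, map_add, map_mul, map_pow, ← hx₁] at hx₂
    rw [← hx₁]
    linear_combination hx₂
  have hvM : v (M ^ p - M) = ((p * -(p ^ 2 * m) : ℤ) : WithTop ℤ) := by
    refine GaloisScaffold.val_sub_eq (val_pow_eq hm p) ?_
    rw [hm]
    have : (p * -(p ^ 2 * m) + 1 : ℤ) ≤ -(p ^ 2 * m) := by
      have : 0 < (p : ℤ) ^ 2 * m := by positivity
      nlinarith
    exact_mod_cast this
  have hvy : v y = ((-(p ^ 2 * m + u) : ℤ) : WithTop ℤ) := by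
    refine val_eq_of_val_pow_sub (p := p) (by nlinarith) ?_
    rw [hwp]
    refine val_add_eq ?_ (v.map_le_add ?_ ?_)
    · rw [v.map_neg, val_mul_eq hvM hvx]
      congr 1
      ring
    · refine le_val_wittPoly hvx.ge hvβ.ge fun i hi hi' => ?_
      have h1 : 0 ≤ (i - 1) * (p * (p - 1) * u) := by
        apply mul_nonneg (by omega)
        have : (0 : ℤ) ≤ p - 1 := by omega
        positivity
      have h2 : (p : ℤ) ^ 2 * ((p - 1) * u) < p ^ 2 * (p * m) :=
        mul_lt_mul_of_pos_left hpm' (by positivity)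
      nlinarith
    · refine le_trans ?_ hε
      have h1 : (p : ℤ) * ((p - 1) * u) ≤ p * ((p - 1) * b₁) :=
        mul_le_mul_of_nonneg_left hub' (by omega)
      have : (p * -(p ^ 2 * m + u) + 1 : ℤ) ≤ p * (-(p * (p * m + u)) + (p - 1) * b₁) + 1 := by
        nlinarith
      exact_mod_cast this
  have hvw : ((-((p - 1) * (p * u)) : ℤ) : WithTop ℤ) ≤ v (wittPoly p x₁ 1) := by
    refine le_val_wittPoly hvx.ge (c := 0) (by simp) fun i hi hi' => ?_
    have : 0 < (p : ℤ) * u := by positivity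
    nlinarith
  have hσ₁y : σ y = y + wittPoly p x₁ 1 - M := by
    rw [hy, map_sub, map_mul, hM, AlgEquiv.commutes, sub_eq_iff_eq_add.1 hσx₁,
      sub_eq_iff_eq_add.1 hσx₂]
    ring
  have hσ₂x : (σ ^ p) x₁ = x₁ := pow_prime_apply_eq_self hσx₁
  have hσ₂y : (σ ^ p) y = y + 1 := by
    rw [hy, map_sub, map_mul, hM, AlgEquiv.commutes, hσ₂x,
      pow_prime_apply_eq_add_one hσx₁ hσx₂]
    ring
  have hdvd : p ∣ Module.finrank κ⸨X⸩ L := by rw [hdeg]; exact dvd_pow_self p two_ne_zero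
  have hpk : ¬ (p : ℤ) ∣ -(p ^ 2 * m + u) := by
    rw [dvd_neg, ← dvd_sub_right (Dvd.dvd.mul_right (dvd_pow_self (p : ℤ) two_ne_zero) m)]
    rwa [sub_add_cancel_left, dvd_neg]
  have hb₁b₂ : b₁ ≤ b₂ := by
    have := hv.le_val_pow_sub hπ hb₁ p
    rw [hb₂] at this
    have : b₁ + 1 ≤ b₂ + 1 := by exact_mod_cast this
    omega
  have hb₁u : b₁ = u := by
    have h1 := hv.val_sub_eq hπ hb₁ hdvd (by omega) hvy hpk
    have h2 : v (σ y - y) = ((-(p ^ 2 * m) : ℤ) : WithTop ℤ) := by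
      rw [hσ₁y, show y + wittPoly p x₁ 1 - M - y = -M + wittPoly p x₁ 1 by ring]
      refine val_add_eq (by rw [v.map_neg, hm]) (le_trans ?_ hvw)
      have : (-(p ^ 2 * m) + 1 : ℤ) ≤ -((p - 1) * (p * u)) := by nlinarith
      exact_mod_cast this
    rw [h1] at h2
    have : -(p ^ 2 * m + u) + b₁ = -(p ^ 2 * m) := by exact_mod_cast h2
    omega
  have hb₂u : b₂ = p ^ 2 * m + u := by
    have h1 := hv.val_sub_eq hπ hb₂ hdvd (by omega) hvy hpk
    rw [hσ₂y, add_sub_cancel_left, v.map_one] at h1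
    have : (0 : ℤ) = -(p ^ 2 * m + u) + b₂ := by exact_mod_cast h1
    omega
  subst hb₁u
  exact
    { apply₁_x := by rw [sub_eq_iff_eq_add.1 hσx₁, add_comm]
      apply₂_x := hσ₂x
      apply₁_y := hσ₁y
      apply₂_y := hσ₂y
      val_x := hvx
      val_y := by rw [hvy, hb₂u]
      le_val_w := hvw
      pos := hu
      not_dvd := hpu
      lt := by rw [hb₂u]; linarith
      dvd_sub := ⟨m, by rw [hb₂u]; ring⟩ }

end

section Linear

variable {κ : Type*} [Field κ] {L : Type*} [Field L] [Algebra κ⸨X⸩ L] [FiniteDimensional κ⸨X⸩ L]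
  {v : AddValuation L (WithTop ℤ)} (hv : IsFullyRamifiedValuation κ v)
  {ι : Type*} [Fintype ι] {y : ι → L} {e : ι → ℤ} (hy : ∀ i, v (y i) = e i)
  (he : ∀ i j, (Module.finrank κ⸨X⸩ L : ℤ) ∣ e i - e j → i = j)
  (hcard : Fintype.card ι = Module.finrank κ⸨X⸩ L)

include hv hy he hcard

/-- A linear map raising the values of a valuation basis by at least `s`, and by exactly `s` at the
index `i`, raises the value of any element with leading index `i` by exactly `s`. -/
theorem IsFullyRamifiedValuation.val_apply_eq {f : Module.End κ⸨X⸩ L} {s : ℤ}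
    (hf : ∀ j, ((e j + s : ℤ) : WithTop ℤ) ≤ v (f (y j))) {i : ι}
    (hi : v (f (y i)) = ((e i + s : ℤ) : WithTop ℤ)) {z : L} {k : ℤ}
    (hz : v z = (((Module.finrank κ⸨X⸩ L : ℤ) * k + e i : ℤ) : WithTop ℤ)) :
    v (f z) = (((Module.finrank κ⸨X⸩ L : ℤ) * k + e i + s : ℤ) : WithTop ℤ) := by
  classical
  obtain ⟨c, rfl⟩ := hv.exists_sum_eq hy he hcard z
  have hc0 : c ≠ 0 := by
    rintro rfl
    simp only [Pi.zero_apply, zero_smul, Finset.sum_const_zero, v.map_zero] at hz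
    exact WithTop.coe_ne_top hz.symm
  obtain ⟨i', hi0, hi1, hi2⟩ := hv.exists_dominant hy he hc0
  obtain ⟨l, -, hl⟩ := hv.exists_val_algebraMap hi0
  rw [hz, val_smul, hl, hy, ← WithTop.coe_add] at hi1
  have h1 : (Module.finrank κ⸨X⸩ L : ℤ) * k + e i = Module.finrank κ⸨X⸩ L * l + e i' := by
    exact_mod_cast hi1
  have h2 : i = i' := he _ _ ⟨l - k, by linarith⟩
  subst h2
  have h3 : k = l := by
    have hpos : (Module.finrank κ⸨X⸩ L : ℤ) ≠ 0 := by
      exact_mod_cast Module.finrank_pos.ne'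
    exact mul_left_cancel₀ hpos (by linarith)
  subst h3
  rw [← Finset.add_sum_erase _ _ (Finset.mem_univ i), map_add, map_smul]
  refine val_add_eq ?_ ?_
  · rw [val_smul, hl, hi, ← WithTop.coe_add, add_assoc]
  · rw [map_sum]
    refine v.map_le_sum fun j hj => ?_
    rw [map_smul]
    by_cases h0 : c j = 0
    · simp [h0]
    have h4 := hi2 j (Finset.ne_of_mem_erase hj)
    obtain ⟨l', -, hl'⟩ := hv.exists_val_algebraMap h0
    rw [val_smul, hl, hy, val_smul, hl', hy, ← WithTop.coe_add, ← WithTop.coe_add] at h4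
    have h5 : (Module.finrank κ⸨X⸩ L : ℤ) * k + e i < Module.finrank κ⸨X⸩ L * l' + e j := by
      exact_mod_cast h4
    have h6 := le_val_mul hl'.ge (hf j)
    rw [← Algebra.smul_def] at h6
    refine le_trans ?_ h6
    exact_mod_cast (by linarith)

end Linear

section Action

variable {K L : Type*} [Field K] [Field L] [Algebra K L]

theorem action_Psi₂ (σ₂ : L ≃ₐ[K] L) : action (Psi₂ σ₂) = delta σ₂ := by
  rw [Psi₂, map_sub, map_one, delta]
  congr 1
  ext z
  exact action_grp σ₂ z

theorem map_truncPow {A B : Type*} [Ring A] [Algebra K A] [Ring B] [Algebra K B] (f : A →ₐ[K] B)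
    (p : ℕ) (g : A) (μ : K) : f (truncPow p g μ) = truncPow p (f g) μ := by
  simp [truncPow, map_sum]

theorem action_Psi₁_apply (p : ℕ) (σ₁ σ₂ : L ≃ₐ[K] L) (μ : K) (z : L) :
    action (Psi₁ p σ₁ σ₂ μ) z =
      σ₁ (∑ k ∈ Finset.range p, binom μ k • (delta σ₂ ^ k) z) - z := by
  have h : action (truncPow p (grp σ₂) μ) =
      ∑ k ∈ Finset.range p, binom μ k • (delta σ₂ ^ k) := by
    rw [← action_Psi₂]
    simp [truncPow, map_sum, Psi₂]
  rw [Psi₁, map_sub, map_one, map_mul, h]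
  simp only [LinearMap.sub_apply, Module.End.mul_apply, Module.End.one_apply, action_grp,
    LinearMap.sum_apply, LinearMap.smul_apply]

theorem delta_pow_mul_of_fixed {σ : L ≃ₐ[K] L} {z : L} (hz : σ z = z) (k : ℕ) (a : L) :
    (delta σ ^ k) (a * z) = (delta σ ^ k) a * z := by
  induction k with
  | zero => simp
  | succ k ih =>
    rw [pow_succ', Module.End.mul_apply, Module.End.mul_apply, ih, delta_apply, delta_apply,
      map_mul, hz, sub_mul]

theorem delta_pow_binom_eq_zero {p : ℕ} [CharP L p] {σ : L ≃ₐ[K] L} {x : L} (hx : σ x - x = 1)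
    {i k : ℕ} (hi : i < p) (hik : i < k) : (delta σ ^ k) (binom x i) = 0 := by
  obtain ⟨d, rfl⟩ := Nat.exists_eq_add_of_lt hik
  have h := delta_pow_binom (p := p) hx i (j := 0) hi
  rw [add_zero] at h
  rw [show i + d + 1 = d + (1 + i) by ring, pow_add, pow_add, Module.End.mul_apply,
    Module.End.mul_apply, h, pow_one, delta_apply, binom_zero, map_one, sub_self, map_zero]

end Action

/-- The values of the basis `binom y i * binom x j`. -/
def scaffoldVal (p : ℕ) (b₁ b₂ : ℤ) (i j : ℕ) : ℤ := -(i * b₂ + j * (p * b₁))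

theorem dd_eq (p : ℕ) (b₁ b₂ : ℤ) (a : ℕ) : dd p b₁ b₂ a = bb p b₁ b₂ a / (p : ℤ) ^ 2 := by
  have := Rat.floor_intCast_div_natCast (bb p b₁ b₂ a) (p ^ 2)
  push_cast at this
  exact this

section Scaffold

variable {p : ℕ} [hp : Fact p.Prime] {κ : Type*} [Field κ] [CharP κ p]
  {L : Type*} [Field L] [Algebra κ⸨X⸩ L] {v : AddValuation L (WithTop ℤ)}
  (hv : IsFullyRamifiedValuation κ v) (hdeg : Module.finrank κ⸨X⸩ L = p ^ 2)
  {σ₁ σ₂ : L ≃ₐ[κ⸨X⸩] L} {μ : κ⸨X⸩} {b₁ b₂ : ℤ} {x y w : L}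
  (h : AdaptedGenerators p v σ₁ σ₂ μ b₁ b₂ x y w)

include h

omit [CharP κ p] in
theorem AdaptedGenerators.pos₂ : 0 < b₂ := by
  have := h.pos
  have := h.lt
  have : 0 < (p : ℤ) ^ 2 * b₁ := by
    have := h.pos
    have := hp.out.pos
    positivity
  linarith

omit [CharP κ p] in
theorem AdaptedGenerators.index_eq {i j i' j' : Fin p}
    (hd : (p : ℤ) ^ 2 ∣ scaffoldVal p b₁ b₂ i j - scaffoldVal p b₁ b₂ i' j') :
    i = i' ∧ j = j' := by
  have hp' := Nat.prime_iff_prime_int.1 hp.out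
  obtain ⟨m, hm⟩ := h.dvd_sub
  have hb₂ : b₂ = b₁ + p ^ 2 * m := by linarith
  have h1 : (p : ℤ) ^ 2 ∣ ((i' : ℕ) - (i : ℕ) + ((j' : ℕ) - (j : ℕ)) * p : ℤ) := by
    have h2 : (p : ℤ) ^ 2 ∣ b₁ * ((i' : ℕ) - (i : ℕ) + ((j' : ℕ) - (j : ℕ)) * p : ℤ) := by
      obtain ⟨q, hq⟩ := hd
      rw [scaffoldVal, scaffoldVal, hb₂] at hq
      exact ⟨q - ((i' : ℕ) - (i : ℕ)) * m, by linear_combination hq⟩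
    exact ((Int.isCoprime_iff_gcd_eq_one.2 (by
      rw [Int.gcd_comm, ← Int.isCoprime_iff_gcd_eq_one]
      exact ((hp'.coprime_iff_not_dvd).2 h.not_dvd).symm)).pow_left.dvd_of_dvd_mul_left h2)
  have hi := i.2
  have hj := j.2
  have hi' := i'.2
  have hj' := j'.2
  have h3 : (p : ℤ) ∣ (i' : ℕ) - (i : ℕ) := by
    have := (dvd_pow_self (p : ℤ) two_ne_zero).trans h1
    rwa [dvd_add_left (dvd_mul_left _ _)] at this
  have h4 := fin_eq_of_dvd_sub h3
  subst h4
  refine ⟨rfl, ?_⟩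
  rw [sub_self, zero_add, pow_two] at h1
  exact (fin_eq_of_dvd_sub ((mul_dvd_mul_iff_right hp'.ne_zero).1 h1)).symm

include hv

theorem AdaptedGenerators.val_binom_mul_binom {i j : ℕ} (hi : i < p) (hj : j < p) :
    v (binom y i * binom x j) = (scaffoldVal p b₁ b₂ i j : WithTop ℤ) := by
  have hpb : 0 < (p : ℤ) * b₁ := by
    have := h.pos
    have := hp.out.pos
    positivity
  rw [val_mul_eq (hv.val_binom h.val_y h.pos₂ hi) (hv.val_binom h.val_x hpb hj), scaffoldVal]
  congr 1
  ring

omit hv hp in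
theorem AdaptedGenerators.action_Psi₁_binom {i j : ℕ} (hi : i < p) :
    action (Psi₁ p σ₁ σ₂ μ) (binom y i * binom x j) =
      binom (y + w) i * binom (x + 1) j - binom y i * binom x j := by
  have : CharP L p := charP_of_algebra_laurentSeries p κ L
  have hfix : σ₂ (binom x j) = binom x j := by
    have := map_binom (σ₂ : L →+* L) x j
    simpa [h.apply₂_x] using this
  have hy : σ₂ y - y = 1 := by rw [h.apply₂_y]; ring
  rw [action_Psi₁_apply]
  congr 1
  have h1 : ∑ k ∈ Finset.range p, binom μ k • (delta σ₂ ^ k) (binom y i * binom x j) =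
      binom (y + algebraMap κ⸨X⸩ L μ) i * binom x j := by
    rw [binom_add p _ _ hi, Finset.sum_mul]
    rw [← Finset.sum_subset (Finset.range_subset_range.2 (show i + 1 ≤ p by omega))]
    · refine Finset.sum_congr rfl fun k hk => ?_
      have hk' : k ≤ i := by simpa [Nat.lt_succ_iff] using hk
      have h2 := delta_pow_binom (p := p) hy k (j := i - k) (by omega)
      rw [show k + (i - k) = i by omega] at h2
      rw [delta_pow_mul_of_fixed hfix, h2, Algebra.smul_def, map_binom]
      ring
    · intro k hk hk'
      rw [Finset.mem_range, not_lt] at hk'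
      rw [delta_pow_mul_of_fixed hfix, delta_pow_binom_eq_zero (p := p) hy hi (by omega), zero_mul,
        smul_zero]
  have h2 := map_binom (σ₁ : L →+* L) (y + algebraMap κ⸨X⸩ L μ) i
  have h3 := map_binom (σ₁ : L →+* L) x j
  simp only [RingHom.coe_coe, map_add, AlgEquiv.commutes, h.apply₁_x, h.apply₁_y] at h2 h3
  rw [h1, map_mul, h2, h3]
  congr 2
  ring

theorem AdaptedGenerators.le_val_binom_add_sub {i j : ℕ} (hi : i < p) (hj : j < p) :
    ((scaffoldVal p b₁ b₂ i j + p * b₁ + 1 : ℤ) : WithTop ℤ) ≤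
      v ((binom (y + w) i - binom y i) * binom (x + 1) j) := by
  have : CharP L p := charP_of_algebra_laurentSeries p κ L
  have hp0 : (1 : ℤ) < p := by exact_mod_cast hp.out.one_lt
  have hpb : 0 < (p : ℤ) * b₁ := mul_pos (by omega) h.pos
  have hx1 : v (x + 1) = ((-(p * b₁) : ℤ) : WithTop ℤ) := by
    refine val_add_eq h.val_x ?_
    rw [v.map_one]
    exact_mod_cast (by omega : -(p * b₁ : ℤ) + 1 ≤ 0)
  rw [binom_add p _ _ hi, Finset.sum_range_succ', binom_zero, mul_one, Nat.sub_zero,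
    add_sub_cancel_right, Finset.sum_mul]
  refine v.map_le_sum fun k hk => ?_
  have hk' := Finset.mem_range.1 hk
  have h1 := le_val_mul (le_val_mul
    (hv.val_binom h.val_y h.pos₂ (show i - (k + 1) < p by omega)).ge
    (hv.le_val_binom h.le_val_w (mul_nonneg (by omega) hpb.le) (show k + 1 < p by omega)))
    (hv.val_binom hx1 hpb hj).ge
  refine le_trans ?_ h1
  rw [scaffoldVal, Nat.cast_sub (by omega)]
  have h2 := h.lt
  have h3 : 0 ≤ (k : ℤ) * (b₂ - (p - 1) * (p * b₁)) := by
    apply mul_nonneg (by omega)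
    nlinarith
  have : (-((i : ℤ) * b₂ + j * (p * b₁)) + p * b₁ + 1) ≤
      -(((i : ℤ) - (k + 1 : ℕ)) * b₂) + -((k + 1 : ℕ) * ((p - 1) * (p * b₁))) +
        -(j * (p * b₁)) := by
    push_cast
    nlinarith
  exact_mod_cast this

theorem AdaptedGenerators.val_action_Psi₁_binom_succ {i j : ℕ} (hi : i < p) (hj : j + 1 < p) :
    v (action (Psi₁ p σ₁ σ₂ μ) (binom y i * binom x (j + 1))) =
      ((scaffoldVal p b₁ b₂ i (j + 1) + p * b₁ : ℤ) : WithTop ℤ) := by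
  have : CharP L p := charP_of_algebra_laurentSeries p κ L
  rw [h.action_Psi₁_binom hi]
  have h1 : binom (y + w) i * binom (x + 1) (j + 1) - binom y i * binom x (j + 1) =
      binom y i * binom x j + (binom (y + w) i - binom y i) * binom (x + 1) (j + 1) := by
    rw [binom_add_one p x hj]
    ring
  have h2 := h.val_binom_mul_binom hv hi (show j < p by omega)
  have h3 : scaffoldVal p b₁ b₂ i j = scaffoldVal p b₁ b₂ i (j + 1) + p * b₁ := by
    rw [scaffoldVal, scaffoldVal]
    push_cast
    ring
  rw [h1]
  rw [h3] at h2
  exact val_add_eq h2 (h.le_val_binom_add_sub hv hi hj)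

theorem AdaptedGenerators.le_val_action_Psi₁_binom {i j : ℕ} (hi : i < p) (hj : j < p) :
    ((scaffoldVal p b₁ b₂ i j + p * b₁ : ℤ) : WithTop ℤ) ≤
      v (action (Psi₁ p σ₁ σ₂ μ) (binom y i * binom x j)) := by
  rcases j with _ | j
  · rw [h.action_Psi₁_binom hi, binom_zero, binom_zero, ← sub_mul]
    have := h.le_val_binom_add_sub hv hi hj
    rw [binom_zero] at this
    exact (WithTop.coe_le_coe.2 (by omega)).trans this
  · exact (h.val_action_Psi₁_binom_succ hv hi hj).ge

omit hv hp in
theorem AdaptedGenerators.action_Psi₂_binom {i j : ℕ} (hi : i + 1 < p) :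
    action (Psi₂ σ₂) (binom y (i + 1) * binom x j) = binom y i * binom x j := by
  have : CharP L p := charP_of_algebra_laurentSeries p κ L
  have hfix : σ₂ (binom x j) = binom x j := by
    have := map_binom (σ₂ : L →+* L) x j
    simpa [h.apply₂_x] using this
  have hy : σ₂ y - y = 1 := by rw [h.apply₂_y]; ring
  rw [action_Psi₂, delta_apply, map_mul, hfix, apply_binom_succ (p := p) hy hi]
  ring

omit hv hp [CharP κ p] in
theorem AdaptedGenerators.action_Psi₂_binom_zero (j : ℕ) :
    action (Psi₂ σ₂) (binom y 0 * binom x j) = 0 := by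
  have hfix : σ₂ (binom x j) = binom x j := by
    have := map_binom (σ₂ : L →+* L) x j
    simpa [h.apply₂_x] using this
  rw [action_Psi₂, delta_apply, binom_zero, one_mul, hfix, sub_self]

theorem AdaptedGenerators.val_action_Psi₂_binom_succ {i j : ℕ} (hi : i + 1 < p) (hj : j < p) :
    v (action (Psi₂ σ₂) (binom y (i + 1) * binom x j)) =
      ((scaffoldVal p b₁ b₂ (i + 1) j + b₂ : ℤ) : WithTop ℤ) := by
  rw [h.action_Psi₂_binom hi, h.val_binom_mul_binom hv (by omega) hj]
  congr 1
  rw [scaffoldVal, scaffoldVal]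
  push_cast
  ring

theorem AdaptedGenerators.le_val_action_Psi₂_binom {i j : ℕ} (hi : i < p) (hj : j < p) :
    ((scaffoldVal p b₁ b₂ i j + b₂ : ℤ) : WithTop ℤ) ≤
      v (action (Psi₂ σ₂) (binom y i * binom x j)) := by
  rcases i with _ | i
  · rw [h.action_Psi₂_binom_zero, v.map_zero]
    exact le_top
  · exact (h.val_action_Psi₂_binom_succ hv hi hj).ge

variable [FiniteDimensional κ⸨X⸩ L]

include hdeg

theorem AdaptedGenerators.val_action_Psi₁ {i j : ℕ} (hi : i < p) (hj : j + 1 < p) {z : L} {k : ℤ}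
    (hz : v z = ((p ^ 2 * k + scaffoldVal p b₁ b₂ i (j + 1) : ℤ) : WithTop ℤ)) :
    v (action (Psi₁ p σ₁ σ₂ μ) z) =
      ((p ^ 2 * k + scaffoldVal p b₁ b₂ i j : ℤ) : WithTop ℤ) := by
  have := hv.val_apply_eq (ι := Fin p × Fin p) (y := fun a => binom y a.1 * binom x a.2)
    (e := fun a => scaffoldVal p b₁ b₂ a.1 a.2)
    (fun a => h.val_binom_mul_binom hv a.1.2 a.2.2)
    (fun a b hab => by
      rw [hdeg] at hab
      push_cast at hab
      obtain ⟨h1, h2⟩ := h.index_eq hab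
      exact Prod.ext h1 h2)
    (by rw [hdeg]; simp [pow_two])
    (fun a => h.le_val_action_Psi₁_binom hv a.1.2 a.2.2)
    (i := (⟨i, hi⟩, ⟨j + 1, hj⟩)) (h.val_action_Psi₁_binom_succ hv hi hj) (z := z) (k := k)
    (by rw [hz, hdeg]; push_cast; rfl)
  rw [this, hdeg]
  congr 1
  simp only [scaffoldVal]
  push_cast
  ring

theorem AdaptedGenerators.val_action_Psi₂ {i j : ℕ} (hi : i + 1 < p) (hj : j < p) {z : L} {k : ℤ}
    (hz : v z = ((p ^ 2 * k + scaffoldVal p b₁ b₂ (i + 1) j : ℤ) : WithTop ℤ)) :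
    v (action (Psi₂ σ₂) z) =
      ((p ^ 2 * k + scaffoldVal p b₁ b₂ i j : ℤ) : WithTop ℤ) := by
  have := hv.val_apply_eq (ι := Fin p × Fin p) (y := fun a => binom y a.1 * binom x a.2)
    (e := fun a => scaffoldVal p b₁ b₂ a.1 a.2)
    (fun a => h.val_binom_mul_binom hv a.1.2 a.2.2)
    (fun a b hab => by
      rw [hdeg] at hab
      push_cast at hab
      obtain ⟨h1, h2⟩ := h.index_eq hab
      exact Prod.ext h1 h2)
    (by rw [hdeg]; simp [pow_two])
    (fun a => h.le_val_action_Psi₂_binom hv a.1.2 a.2.2)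
    (i := (⟨i + 1, hi⟩, ⟨j, hj⟩)) (h.val_action_Psi₂_binom_succ hv hi hj) (z := z) (k := k)
    (by rw [hz, hdeg]; push_cast; rfl)
  rw [this, hdeg]
  congr 1
  simp only [scaffoldVal]
  push_cast
  ring

theorem AdaptedGenerators.val_action_Psi {z : L} {k : ℤ}
    (hz : v z = ((p ^ 2 * k + scaffoldVal p b₁ b₂ (p - 1) (p - 1) : ℤ) : WithTop ℤ))
    {a : ℕ} (ha : a < p ^ 2) :
    v (action (Psi p σ₁ σ₂ μ a) z) =
      ((p ^ 2 * k + scaffoldVal p b₁ b₂ (p - 1 - a / p) (p - 1 - a % p) : ℤ) : WithTop ℤ) := by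
  have hp0 := hp.out.pos
  have h1 : ∀ j < p, v (action (Psi₁ p σ₁ σ₂ μ ^ j) z) =
      ((p ^ 2 * k + scaffoldVal p b₁ b₂ (p - 1) (p - 1 - j) : ℤ) : WithTop ℤ) := by
    intro j
    induction j with
    | zero => intro _; simpa using hz
    | succ j ih =>
      intro hj
      rw [pow_succ', map_mul, Module.End.mul_apply]
      refine h.val_action_Psi₁ hv hdeg (by omega) (by omega) ?_
      rw [ih (by omega), show p - 1 - (j + 1) + 1 = p - 1 - j by omega]
  have h2 : ∀ i < p, v (action (Psi₂ σ₂ ^ i * Psi₁ p σ₁ σ₂ μ ^ (a % p)) z) =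
      ((p ^ 2 * k + scaffoldVal p b₁ b₂ (p - 1 - i) (p - 1 - a % p) : ℤ) : WithTop ℤ) := by
    intro i
    induction i with
    | zero =>
      intro _
      simpa using h1 _ (Nat.mod_lt _ hp0)
    | succ i ih =>
      intro hi
      rw [pow_succ', mul_assoc, map_mul, Module.End.mul_apply]
      refine h.val_action_Psi₂ hv hdeg (by omega) (by omega) ?_
      rw [ih (by omega), show p - 1 - (i + 1) + 1 = p - 1 - i by omega]
  exact h2 _ (Nat.div_lt_of_lt_mul (by rwa [pow_two] at ha))

/-- The values of `Ψ^(a) ρ` for `ρ` with `v ρ = r(b₂)`. -/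
theorem AdaptedGenerators.val_action_Psi_of_val_eq_mod {ρ : L}
    (hρ : v ρ = ((b₂ % (p : ℤ) ^ 2 : ℤ) : WithTop ℤ)) {a : ℕ} (ha : a < p ^ 2) :
    v (action (Psi p σ₁ σ₂ μ a) ρ) =
      ((bb p b₁ b₂ a - p ^ 2 * dd p b₁ b₂ 0 : ℤ) : WithTop ℤ) := by
  have hp0 := hp.out.pos
  obtain ⟨m, hm⟩ := h.dvd_sub
  have hd0 : dd p b₁ b₂ 0 = b₂ / (p : ℤ) ^ 2 := by
    rw [dd_eq]
    simp [bb]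
  have h1 := Int.emod_add_mul_ediv b₂ ((p : ℤ) ^ 2)
  have h2 : a / p < p := Nat.div_lt_of_lt_mul (by rwa [pow_two] at ha)
  have h3 : a % p < p := Nat.mod_lt _ hp0
  rw [h.val_action_Psi hv hdeg (k := b₁ + p * m - b₂ / (p : ℤ) ^ 2) ?_ ha, hd0]
  · congr 1
    have hc1 : ((p - 1 - a / p : ℕ) : ℤ) = p - 1 - (a / p : ℕ) := by omega
    have hc2 : ((p - 1 - a % p : ℕ) : ℤ) = p - 1 - (a % p : ℕ) := by omega
    rw [bb, scaffoldVal, hc1, hc2]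
    linear_combination (-(p : ℤ)) * hm
  · rw [hρ]
    congr 1
    have hc : ((p - 1 : ℕ) : ℤ) = p - 1 := by omega
    rw [scaffoldVal, hc]
    linear_combination h1 + (p : ℤ) * hm

end Scaffold

section Laurent

variable {κ : Type*} [Field κ]

theorem orderTop_X_zpow (k : ℤ) :
    ((HahnSeries.single (1 : ℤ) (1 : κ) : κ⸨X⸩) ^ k).orderTop = k := by
  rw [← RatFunc.single_zpow, HahnSeries.orderTop_single one_ne_zero]

theorem orderTop_algebraMap_powerSeries_nonneg (f : κ⟦X⟧) :
    0 ≤ (algebraMap κ⟦X⟧ κ⸨X⸩ f).orderTop := by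
  rw [HahnSeries.le_orderTop_iff_forall]
  intro i hi
  have hi' : i < 0 := by exact_mod_cast hi
  rw [LaurentSeries.coe_algebraMap, PowerSeries.coeff_coe, if_pos hi']

theorem exists_powerSeries_of_orderTop_nonneg {c : κ⸨X⸩} (hc : 0 ≤ c.orderTop) :
    ∃ f : κ⟦X⟧, algebraMap κ⟦X⟧ κ⸨X⸩ f = c := by
  rw [HahnSeries.zero_le_orderTop_iff] at hc
  obtain ⟨n, hn⟩ := Int.eq_ofNat_of_zero_le hc
  refine ⟨PowerSeries.X ^ n * c.powerSeriesPart, ?_⟩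
  rw [LaurentSeries.coe_algebraMap]
  exact LaurentSeries.X_order_mul_powerSeriesPart hn.symm

theorem orderTop_mul_X_zpow (c : κ⸨X⸩) (k : ℤ) :
    (c * (HahnSeries.single (1 : ℤ) (1 : κ) : κ⸨X⸩) ^ k).orderTop = c.orderTop + (k : WithTop ℤ) := by
  rw [HahnSeries.orderTop_mul, orderTop_X_zpow]

theorem le_orderTop_iff_exists_powerSeries {c : κ⸨X⸩} {k : ℤ} :
    (k : WithTop ℤ) ≤ c.orderTop ↔
      ∃ f : κ⟦X⟧, f • (HahnSeries.single (1 : ℤ) (1 : κ) : κ⸨X⸩) ^ k = c := by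
  have ht : (HahnSeries.single (1 : ℤ) (1 : κ) : κ⸨X⸩) ≠ 0 := by simp
  constructor
  · intro h
    obtain ⟨f, hf⟩ := exists_powerSeries_of_orderTop_nonneg
      (c := c * (HahnSeries.single (1 : ℤ) (1 : κ) : κ⸨X⸩) ^ (-k)) (by
        rw [orderTop_mul_X_zpow]
        have := add_le_add_left h ((-k : ℤ) : WithTop ℤ)
        rwa [← WithTop.coe_add, add_neg_cancel] at this)
    refine ⟨f, ?_⟩
    rw [Algebra.smul_def, hf, mul_assoc, ← zpow_add₀ ht, neg_add_cancel, zpow_zero, mul_one]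
  · rintro ⟨f, rfl⟩
    rw [Algebra.smul_def, orderTop_mul_X_zpow]
    exact le_add_of_nonneg_left (orderTop_algebraMap_powerSeries_nonneg f)

theorem le_orderTop_sum {ι : Type*} {s : Finset ι} {f : ι → κ⸨X⸩} {m : WithTop ℤ}
    (h : ∀ i ∈ s, m ≤ (f i).orderTop) : m ≤ (∑ i ∈ s, f i).orderTop := by
  have := (HahnSeries.addVal ℤ κ).map_le_sum (s := s) (f := f) (g := m)
    (by simpa only [HahnSeries.addVal_apply] using h)
  rwa [HahnSeries.addVal_apply] at this

end Laurent

/-- A nilpotent element `Ψ` of the group algebra, of order of nilpotency `N = [L : K]`, whose powers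
map `ρ` to elements whose values form a complete system of residues modulo `N`; these values are
`N (d_a - d_0) + r_a`. -/
structure PowerScaffold {K L : Type*} [Field K] [Field L] [Algebra K L]
    (v : AddValuation L (WithTop ℤ)) (Ψ : MonoidAlgebra K (L ≃ₐ[K] L)) (N : ℕ) (d r : ℕ → ℤ)
    (ρ : L) : Prop where
  finrank_eq : Module.finrank K L = N
  pow_eq_zero : Ψ ^ N = 0
  val_pow : ∀ a < N, v (action (Ψ ^ a) ρ) = ((N * (d a - d 0) + r a : ℤ) : WithTop ℤ)
  r_nonneg : ∀ a < N, 0 ≤ r a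
  r_lt : ∀ a < N, r a < N
  r_inj : ∀ a < N, ∀ b < N, r a = r b → a = b

/-- `w_j = min {d_{j+a} - d_a : j + a < N}`. -/
def IsMinDiff (N : ℕ) (d : ℕ → ℤ) (w : Fin N → ℤ) : Prop :=
  (∀ (j : Fin N) (a : ℕ), j + a < N → w j ≤ d (j + a) - d a) ∧
    ∀ j : Fin N, ∃ a : ℕ, j + a < N ∧ w j = d (j + a) - d a

namespace PowerScaffold

open Polynomial

variable {κ : Type*} [Field κ] {L : Type*} [Field L] [Algebra κ⸨X⸩ L]
  {v : AddValuation L (WithTop ℤ)} (hv : IsFullyRamifiedValuation κ v)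
  {Ψ : MonoidAlgebra κ⸨X⸩ (L ≃ₐ[κ⸨X⸩] L)} {N : ℕ} {d r : ℕ → ℤ} {ρ : L}
  (h : PowerScaffold v Ψ N d r ρ)

include h

theorem dvd_sub {i j : Fin N}
    (hd : (Module.finrank κ⸨X⸩ L : ℤ) ∣
      (N * (d i - d 0) + r i) - (N * (d j - d 0) + r j)) : i = j := by
  rw [h.finrank_eq] at hd
  have h1 : (N : ℤ) ∣ r i - r j := by
    have h2 : (N * (d i - d 0) + r i) - (N * (d j - d 0) + r j) =
      N * (d i - d j) + (r i - r j) := by ring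
    rw [h2] at hd
    exact (dvd_add_right (dvd_mul_right _ _)).1 hd
  have h2 := h.r_nonneg i i.2
  have h3 := h.r_nonneg j j.2
  have h4 := h.r_lt i i.2
  have h5 := h.r_lt j j.2
  have h6 := Int.eq_zero_of_abs_lt_dvd h1 (by rw [abs_lt]; omega)
  exact Fin.ext (h.r_inj i i.2 j j.2 (by omega))

theorem aeval_eq_sum (P : κ⸨X⸩[X]) :
    aeval Ψ P = ∑ j ∈ Finset.range N, P.coeff j • Ψ ^ j := by
  rw [aeval_eq_sum_range' (n := P.natDegree + 1 + N) (by omega)]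
  symm
  apply Finset.sum_subset (Finset.range_subset_range.2 (by omega))
  intro j _ hj
  rw [Finset.mem_range, not_lt] at hj
  rw [← Nat.add_sub_cancel' hj, pow_add, h.pow_eq_zero, zero_mul, smul_zero]

theorem action_aeval (P : κ⸨X⸩[X]) :
    action (aeval Ψ P) ρ = ∑ j : Fin N, P.coeff j • action (Ψ ^ (j : ℕ)) ρ := by
  rw [h.aeval_eq_sum, Finset.sum_range, map_sum, LinearMap.sum_apply]
  simp

include hv

theorem zero_le_val_smul_iff {j : ℕ} (hj : j < N) (c : κ⸨X⸩) :
    0 ≤ v (c • action (Ψ ^ j) ρ) ↔ ((d 0 - d j : ℤ) : WithTop ℤ) ≤ c.orderTop := by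
  by_cases hc : c = 0
  · simp [hc]
  obtain ⟨k, hk, hk'⟩ := hv.exists_val_smul hc (h.val_pow j hj)
  rw [hk, hk', h.finrank_eq]
  have h1 := h.r_nonneg j hj
  have h2 := h.r_lt j hj
  have h3 : (0 : WithTop ℤ) = ((0 : ℤ) : WithTop ℤ) := rfl
  rw [h3, WithTop.coe_le_coe, WithTop.coe_le_coe]
  have h4 : (N : ℤ) * k + (N * (d j - d 0) + r j) = N * (k - (d 0 - d j)) + r j := by ring
  rw [h4]
  constructor
  · intro h5
    by_contra h6
    nlinarith
  · intro h5
    have : 0 ≤ k - (d 0 - d j) := by omega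
    positivity

theorem mem_valRing_iff (P : κ⸨X⸩[X]) :
    action (aeval Ψ P) ρ ∈ valRing v ↔
      ∀ j < N, ((d 0 - d j : ℤ) : WithTop ℤ) ≤ (P.coeff j).orderTop := by
  change 0 ≤ v _ ↔ _
  rw [h.action_aeval, hv.le_val_sum_iff (e := fun j : Fin N => N * (d j - d 0) + r j)
    (fun j => h.val_pow j j.2) (fun i j hij => h.dvd_sub hij)]
  constructor
  · exact fun h' j hj => (h.zero_le_val_smul_iff hv hj _).1 (h' ⟨j, hj⟩)
  · exact fun h' j => (h.zero_le_val_smul_iff hv j.2 _).2 (h' j j.2)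

theorem linearIndependent_action :
    LinearIndependent κ⸨X⸩ (fun j : Fin N => action (Ψ ^ (j : ℕ)) ρ) :=
  hv.linearIndependent_of_val (e := fun j : Fin N => N * (d j - d 0) + r j)
    (fun j => h.val_pow j j.2) (fun _ _ hij => h.dvd_sub hij)

theorem action_aeval_eq_zero_iff (P : κ⸨X⸩[X]) :
    action (aeval Ψ P) ρ = 0 ↔ ∀ j < N, P.coeff j = 0 := by
  rw [h.action_aeval]
  constructor
  · intro h' j hj
    exact (Fintype.linearIndependent_iff.1 (h.linearIndependent_action hv)) _ h' ⟨j, hj⟩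
  · intro h'
    exact Finset.sum_eq_zero fun j _ => by rw [h' j j.2, zero_smul]

theorem linearIndependent_pow : LinearIndependent κ⸨X⸩ (fun j : Fin N => Ψ ^ (j : ℕ)) :=
  LinearIndependent.of_comp
    ((LinearMap.applyₗ ρ).comp (action (K := κ⸨X⸩) (L := L)).toLinearMap)
    (h.linearIndependent_action hv)

variable [FiniteDimensional κ⸨X⸩ L]

theorem exists_action_aeval_eq (z : L) : ∃ P : κ⸨X⸩[X], action (aeval Ψ P) ρ = z := by
  obtain ⟨c, hc⟩ := hv.exists_sum_eq (e := fun j : Fin N => N * (d j - d 0) + r j)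
    (fun j => h.val_pow j j.2) (fun _ _ hij => h.dvd_sub hij) (by simp [h.finrank_eq]) z
  refine ⟨∑ j : Fin N, C (c j) * X ^ (j : ℕ), ?_⟩
  rw [hc, map_sum, map_sum, LinearMap.sum_apply]
  refine Finset.sum_congr rfl fun j _ => ?_
  rw [map_mul, aeval_C, map_pow, aeval_X, ← Algebra.smul_def, map_smul, LinearMap.smul_apply]

variable [IsGalois κ⸨X⸩ L]

theorem exists_aeval_eq (α : MonoidAlgebra κ⸨X⸩ (L ≃ₐ[κ⸨X⸩] L)) :
    ∃ P : κ⸨X⸩[X], aeval Ψ P = α := by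
  have b := MonoidAlgebra.basis (L ≃ₐ[κ⸨X⸩] L) κ⸨X⸩
  have : Module.Finite κ⸨X⸩ (MonoidAlgebra κ⸨X⸩ (L ≃ₐ[κ⸨X⸩] L)) := Module.Finite.of_basis b
  have hfin : Fintype.card (Fin N) =
      Module.finrank κ⸨X⸩ (MonoidAlgebra κ⸨X⸩ (L ≃ₐ[κ⸨X⸩] L)) := by
    rw [Module.finrank_eq_nat_card_basis b, IsGalois.card_aut_eq_finrank, h.finrank_eq,
      Fintype.card_fin]
  have hs := (h.linearIndependent_pow hv).span_eq_top_of_card_eq_finrank' hfin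
  have hα : α ∈ Submodule.span κ⸨X⸩ (Set.range fun j : Fin N => Ψ ^ (j : ℕ)) := by
    rw [hs]; trivial
  obtain ⟨c, hc⟩ := (Submodule.mem_span_range_iff_exists_fun _).1 hα
  refine ⟨∑ j : Fin N, C (c j) * X ^ (j : ℕ), ?_⟩
  rw [← hc, map_sum]
  refine Finset.sum_congr rfl fun j _ => ?_
  rw [map_mul, aeval_C, map_pow, aeval_X, ← Algebra.smul_def]

omit [IsGalois κ⸨X⸩ L] in
/-- The associated order in terms of coefficients. -/
theorem mem_associatedOrder_iff {w : Fin N → ℤ} (hw : IsMinDiff N d w) (P : κ⸨X⸩[X]) :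
    aeval Ψ P ∈ associatedOrder κ⸨X⸩ v ↔
      ∀ j : Fin N, ((-w j : ℤ) : WithTop ℤ) ≤ (P.coeff j).orderTop := by
  constructor
  · intro hP j
    obtain ⟨a, ha, hwa⟩ := hw.2 j
    set t := (HahnSeries.single (1 : ℤ) (1 : κ) : κ⸨X⸩) ^ (d 0 - d a) with ht
    have h1 : action (aeval Ψ (C t * X ^ a)) ρ ∈ valRing v := by
      rw [h.mem_valRing_iff hv]
      intro i hi
      rw [coeff_C_mul_X_pow]
      split_ifs with hia
      · rw [hia, ht, orderTop_X_zpow]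
      · simp
    have h2 := hP _ h1
    rw [← Module.End.mul_apply, ← map_mul, ← map_mul, ← mul_assoc, h.mem_valRing_iff hv] at h2
    have h3 := h2 (j + a) ha
    rw [coeff_mul_X_pow, coeff_mul_C, ht, orderTop_mul_X_zpow] at h3
    rw [hwa]
    cases hc : (P.coeff j).orderTop with
    | top => exact le_top
    | coe c =>
      rw [hc, ← WithTop.coe_add, WithTop.coe_le_coe] at h3
      rw [WithTop.coe_le_coe]
      omega
  · intro hP x hx
    obtain ⟨Q, rfl⟩ := h.exists_action_aeval_eq hv x
    rw [h.mem_valRing_iff hv] at hx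
    rw [← Module.End.mul_apply, ← map_mul, ← map_mul, h.mem_valRing_iff hv]
    intro k hk
    rw [coeff_mul]
    refine le_orderTop_sum fun i hi => ?_
    rw [Finset.HasAntidiagonal.mem_antidiagonal] at hi
    rw [HahnSeries.orderTop_mul]
    have h1 : i.1 + i.2 < N := by omega
    have h2 := hw.1 ⟨i.1, by omega⟩ i.2 h1
    rw [← hi]
    refine le_trans ?_ (add_le_add (hP ⟨i.1, by omega⟩) (hx i.2 (by omega)))
    rw [← WithTop.coe_add, WithTop.coe_le_coe]
    simp only at h2
    omega

/-- The basis of the associated order. -/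
theorem basis_associatedOrder {w : Fin N → ℤ} (hw : IsMinDiff N d w) :
    LinearIndependent κ⟦X⟧ (fun j : Fin N =>
        ((HahnSeries.single (1 : ℤ) (1 : κ) : κ⸨X⸩) ^ (-w j)) • Ψ ^ (j : ℕ)) ∧
      (Submodule.span κ⟦X⟧ (Set.range (fun j : Fin N =>
        ((HahnSeries.single (1 : ℤ) (1 : κ) : κ⸨X⸩) ^ (-w j)) • Ψ ^ (j : ℕ))) :
          Set (MonoidAlgebra κ⸨X⸩ (L ≃ₐ[κ⸨X⸩] L))) = associatedOrder κ⸨X⸩ v := by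
  have ht : (HahnSeries.single (1 : ℤ) (1 : κ) : κ⸨X⸩) ≠ 0 := by simp
  constructor
  · refine LinearIndependent.restrict_scalars (K := κ⸨X⸩) ?_ ?_
    · intro f g hfg
      simp only [← Algebra.algebraMap_eq_smul_one] at hfg
      exact IsFractionRing.injective κ⟦X⟧ κ⸨X⸩ hfg
    · exact (h.linearIndependent_pow hv).units_smul
        fun j => Units.mk0 _ (zpow_ne_zero (-w j) ht)
  · ext α
    rw [SetLike.mem_coe, SetLike.mem_coe, Submodule.mem_span_range_iff_exists_fun]
    obtain ⟨P, rfl⟩ := h.exists_aeval_eq hv α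
    rw [h.mem_associatedOrder_iff hv hw, h.aeval_eq_sum, Finset.sum_range]
    constructor
    · rintro ⟨c, hc⟩ j
      rw [le_orderTop_iff_exists_powerSeries]
      refine ⟨c j, ?_⟩
      have h1 : ∑ j : Fin N, (c j • (HahnSeries.single (1 : ℤ) (1 : κ) : κ⸨X⸩) ^ (-w j) -
          P.coeff j) • Ψ ^ (j : ℕ) = 0 := by
        simp only [sub_smul, Finset.sum_sub_distrib, smul_assoc]
        rw [hc, sub_self]
      exact sub_eq_zero.1 (Fintype.linearIndependent_iff.1 (h.linearIndependent_pow hv) _ h1 j)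
    · intro hP
      choose c hc using fun j => le_orderTop_iff_exists_powerSeries.1 (hP j)
      refine ⟨c, Finset.sum_congr rfl fun j _ => ?_⟩
      rw [← smul_assoc, hc]

/-- If `w_j = d_j - d_0` for all `j`, then `ρ` is a free generator. -/
theorem bijective_smul {w : Fin N → ℤ} (hw : IsMinDiff N d w) (hwd : ∀ j, w j = d j - d 0)
    (hρ : ρ ∈ valRing v) :
    Function.Bijective (fun α : associatedOrder κ⸨X⸩ v => α • (⟨ρ, hρ⟩ : valRing v)) := by
  constructor
  · rintro ⟨α, hα⟩ ⟨β, hβ⟩ hαβ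
    have h1 : action α ρ = action β ρ := congrArg Subtype.val hαβ
    obtain ⟨P, hP⟩ := h.exists_aeval_eq hv (α - β)
    have h2 : action (aeval Ψ P) ρ = 0 := by
      rw [hP, map_sub, LinearMap.sub_apply, h1, sub_self]
    rw [h.action_aeval_eq_zero_iff hv] at h2
    refine Subtype.ext (sub_eq_zero.1 ?_)
    rw [← hP, h.aeval_eq_sum]
    exact Finset.sum_eq_zero fun j hj => by rw [h2 j (Finset.mem_range.1 hj), zero_smul]
  · rintro ⟨x, hx⟩
    obtain ⟨P, rfl⟩ := h.exists_action_aeval_eq hv x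
    rw [h.mem_valRing_iff hv] at hx
    refine ⟨⟨aeval Ψ P, (h.mem_associatedOrder_iff hv hw P).2 fun j => ?_⟩, rfl⟩
    rw [hwd]
    refine le_trans ?_ (hx j j.2)
    rw [WithTop.coe_le_coe]
    omega

/-- Every element of the group algebra can be scaled into the associated order. -/
theorem exists_smul_mem {w : Fin N → ℤ} (hw : IsMinDiff N d w)
    (α : MonoidAlgebra κ⸨X⸩ (L ≃ₐ[κ⸨X⸩] L)) : ∃ m : ℤ, ∀ m' ≥ m,
      (HahnSeries.single (1 : ℤ) (1 : κ) : κ⸨X⸩) ^ m' • α ∈ associatedOrder κ⸨X⸩ v := by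
  obtain ⟨P, rfl⟩ := h.exists_aeval_eq hv α
  have h1 : ∀ j : Fin N, ∃ m : ℤ, ∀ m' ≥ m,
      ((-w j : ℤ) : WithTop ℤ) ≤ (P.coeff j).orderTop + (m' : WithTop ℤ) := by
    intro j
    cases (P.coeff j).orderTop with
    | top => exact ⟨0, fun _ _ => by simp⟩
    | coe c =>
      refine ⟨-w j - c, fun m' hm' => ?_⟩
      rw [← WithTop.coe_add, WithTop.coe_le_coe]
      omega
  choose m hm using h1
  obtain ⟨M, hM⟩ := (Finset.univ.image m).exists_le
  refine ⟨M, fun m' hm' => ?_⟩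
  have h2 : (HahnSeries.single (1 : ℤ) (1 : κ) : κ⸨X⸩) ^ m' • aeval Ψ P =
      aeval Ψ (P * C ((HahnSeries.single (1 : ℤ) (1 : κ) : κ⸨X⸩) ^ m')) := by
    rw [mul_comm, map_mul, aeval_C, Algebra.smul_def]
  rw [h2, h.mem_associatedOrder_iff hv hw]
  intro j
  rw [coeff_mul_C, orderTop_mul_X_zpow]
  exact hm j m' ((hM _ (Finset.mem_image_of_mem m (Finset.mem_univ j))).trans hm')

/-- A basis of the valuation ring over its associated order has at most one element. -/
theorem subsingleton_of_basis {w : Fin N → ℤ} (hw : IsMinDiff N d w) {ι : Type*}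
    (b : Module.Basis ι (associatedOrder κ⸨X⸩ v) (valRing v)) : Subsingleton ι := by
  classical
  have ht : (HahnSeries.single (1 : ℤ) (1 : κ) : κ⸨X⸩) ≠ 0 := by simp
  refine ⟨fun i j => ?_⟩
  by_contra hij
  obtain ⟨P, hP⟩ := h.exists_action_aeval_eq hv (b i : L)
  obtain ⟨Q, hQ⟩ := h.exists_action_aeval_eq hv (b j : L)
  obtain ⟨m₁, hm₁⟩ := h.exists_smul_mem hv hw (aeval Ψ P)
  obtain ⟨m₂, hm₂⟩ := h.exists_smul_mem hv hw (aeval Ψ Q)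
  set t := (HahnSeries.single (1 : ℤ) (1 : κ) : κ⸨X⸩) ^ (max m₁ m₂) with htm
  let α : associatedOrder κ⸨X⸩ v := ⟨t • aeval Ψ P, hm₁ _ (le_max_left _ _)⟩
  let β : associatedOrder κ⸨X⸩ v := ⟨t • aeval Ψ Q, hm₂ _ (le_max_right _ _)⟩
  have h1 : β • b i + (-α) • b j = 0 := by
    rw [neg_smul]
    refine add_neg_eq_zero.2 (Subtype.ext ?_)
    rw [coe_smul, coe_smul, ← hP, ← hQ]
    change action (t • aeval Ψ Q) _ = action (t • aeval Ψ P) _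
    rw [map_smul, map_smul, LinearMap.smul_apply, LinearMap.smul_apply, ← Module.End.mul_apply,
      ← Module.End.mul_apply, ← map_mul, ← map_mul, ← map_mul, ← map_mul, mul_comm]
  have h2 := linearIndependent_iff'.1 b.linearIndependent {i, j}
    (fun k => if k = i then β else -α)
    (by rw [Finset.sum_pair hij, if_pos rfl, if_neg (Ne.symm hij)]; exact h1) i (by simp)
  rw [if_pos rfl] at h2
  have h3 : t • aeval Ψ Q = 0 := congrArg Subtype.val h2
  have h4 : aeval Ψ Q = 0 := (smul_eq_zero.1 h3).resolve_left (zpow_ne_zero _ ht)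
  apply b.ne_zero j
  apply Subtype.ext
  rw [← hQ, h4, map_zero]
  rfl

/-- If the valuation ring is free over its associated order, then `w_j = d_j - d_0`. -/
theorem minDiff_eq_of_free {w : Fin N → ℤ} (hw : IsMinDiff N d w)
    [hfree : Module.Free (associatedOrder κ⸨X⸩ v) (valRing v)] (j : Fin N) :
    w j = d j - d 0 := by
  obtain ⟨⟨ι, b⟩⟩ := Module.Free.exists_basis (associatedOrder κ⸨X⸩ v) (valRing v)
  have hsub := h.subsingleton_of_basis hv hw b
  obtain ⟨i₀⟩ := b.index_nonempty
  have hgen : ∀ x : valRing v, ∃ α : associatedOrder κ⸨X⸩ v, α • b i₀ = x := by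
    intro x
    have : Fintype ι := Fintype.ofSubsingleton i₀
    refine ⟨b.repr x i₀, ?_⟩
    conv_rhs => rw [← b.sum_repr x]
    rw [Fintype.sum_subsingleton _ i₀]
  obtain ⟨Q, hQ⟩ := h.exists_action_aeval_eq hv (b i₀ : L)
  have hQ0 := (h.mem_valRing_iff hv Q).1 (by rw [hQ]; exact (b i₀).2)
  have hkey : ∀ i : Fin N, ∃ P : κ⸨X⸩[X],
      (∀ k : Fin N, ((-w k : ℤ) : WithTop ℤ) ≤ (P.coeff k).orderTop) ∧
      ∀ k < N, (P * Q).coeff k =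
        if k = i then (HahnSeries.single (1 : ℤ) (1 : κ) : κ⸨X⸩) ^ (d 0 - d i) else 0 := by
    intro i
    set t := (HahnSeries.single (1 : ℤ) (1 : κ) : κ⸨X⸩) ^ (d 0 - d i) with ht
    have h1 : action (aeval Ψ (C t * X ^ (i : ℕ))) ρ ∈ valRing v := by
      rw [h.mem_valRing_iff hv]
      intro k hk
      rw [coeff_C_mul_X_pow]
      split_ifs with hki
      · rw [hki, ht, orderTop_X_zpow]
      · simp
    obtain ⟨⟨α, hα⟩, hα'⟩ := hgen ⟨_, h1⟩
    obtain ⟨P, rfl⟩ := h.exists_aeval_eq hv α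
    refine ⟨P, (h.mem_associatedOrder_iff hv hw P).1 hα, fun k hk => ?_⟩
    have h2 : action (aeval Ψ P) (b i₀ : L) = action (aeval Ψ (C t * X ^ (i : ℕ))) ρ :=
      congrArg Subtype.val hα'
    rw [← hQ, ← Module.End.mul_apply, ← map_mul, ← map_mul, ← sub_eq_zero,
      ← LinearMap.sub_apply, ← map_sub, ← map_sub, h.action_aeval_eq_zero_iff hv] at h2
    have h3 := h2 k hk
    rw [coeff_sub, coeff_C_mul_X_pow] at h3
    exact sub_eq_zero.1 h3
  have hN : 0 < N := j.pos
  have ht0 : ∀ k : ℤ, (HahnSeries.single (1 : ℤ) (1 : κ) : κ⸨X⸩) ^ k ≠ 0 :=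
    fun k => zpow_ne_zero _ (by simp)
  have hQ00 : Q.coeff 0 ≠ 0 := by
    obtain ⟨P, -, hP⟩ := hkey ⟨0, hN⟩
    have := hP 0 hN
    rw [if_pos rfl, mul_coeff_zero] at this
    intro h0
    rw [h0, mul_zero] at this
    exact ht0 _ this.symm
  refine le_antisymm (hw.1 j 0 (by simp)) ?_
  obtain ⟨P, hPw, hP⟩ := hkey j
  have hstep : ∀ k : ℕ, (∀ i < k, P.coeff i = 0) → (P * Q).coeff k = P.coeff k * Q.coeff 0 := by
    intro k hk
    rw [coeff_mul, Finset.sum_eq_single (k, 0)]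
    · rintro ⟨i, l⟩ hil hne
      rw [Finset.HasAntidiagonal.mem_antidiagonal] at hil
      simp only at hil ⊢
      have : i < k := by
        rcases Nat.eq_zero_or_pos l with rfl | hl
        · rw [add_zero] at hil
          exact absurd (by rw [hil]) hne
        · omega
      rw [hk i this, zero_mul]
    · intro hk'
      simp at hk'
  have hzero : ∀ i < (j : ℕ), P.coeff i = 0 := by
    intro i
    induction i using Nat.strong_induction_on with
    | _ i ih =>
      intro hij
      have h1 := hstep i fun l hl => ih l hl (by omega)
      rw [hP i (by omega), if_neg (by omega)] at h1
      exact (mul_eq_zero.1 h1.symm).resolve_right hQ00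
  have h1 := hstep j hzero
  rw [hP j j.2, if_pos rfl] at h1
  have h2 := congrArg HahnSeries.orderTop h1
  rw [orderTop_X_zpow, HahnSeries.orderTop_mul] at h2
  have h3 := add_le_add (hPw j) (hQ0 0 hN)
  rw [← h2, ← WithTop.coe_add, WithTop.coe_le_coe] at h3
  omega

end PowerScaffold

section GroupAlgebra

variable {K L : Type*} [Field K] [Field L] [Algebra K L]

open Polynomial in
theorem sub_one_pow_dvd_truncPow_pow_sub_one (p : ℕ) [hp : Fact p.Prime] [CharP K p] (μ : K) (g : K[X]) :
    (g - 1) ^ p ∣ truncPow p g μ ^ p - 1 := by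
  have h1 : g - 1 ∣ truncPow p g μ - 1 := by
    obtain ⟨q, hq⟩ := Nat.exists_eq_succ_of_ne_zero hp.out.ne_zero
    rw [truncPow, hq, Finset.sum_range_succ', binom_zero, pow_zero, one_smul, add_sub_cancel_right]
    refine Finset.dvd_sum fun k _ => ?_
    rw [pow_succ', smul_eq_C_mul]
    exact Dvd.dvd.mul_left (dvd_mul_right _ _) _
  have h2 := pow_dvd_pow_of_dvd h1 p
  rwa [sub_pow_char (truncPow p g μ) 1, one_pow] at h2

open Polynomial in
/-- `Ψ₁ ^ p = Ψ₂`. -/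
theorem Psi₁_pow_prime (p : ℕ) [hp : Fact p.Prime] [CharP K p] (σ : L ≃ₐ[K] L)
    (hσ : σ ^ (p ^ 2) = 1) (μ : K) : Psi₁ p σ (σ ^ p) μ ^ p = Psi₂ (σ ^ p) := by
  have hgrp : ∀ k : ℕ, grp (σ ^ k) = grp σ ^ k := fun k => by simp [grp]
  have hΨ : Psi₁ p σ (σ ^ p) μ = aeval (grp σ) (X * truncPow p (X ^ p : K[X]) μ - 1) := by
    rw [Psi₁, map_sub, map_one, map_mul, aeval_X, map_truncPow, map_pow, aeval_X, hgrp]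
  obtain ⟨R, hR⟩ := sub_one_pow_dvd_truncPow_pow_sub_one p μ (X ^ p : K[X])
  have h1 : (X * truncPow p (X ^ p : K[X]) μ - 1) ^ p =
      (X ^ p - 1) + X ^ p * ((X ^ (p ^ 2) - 1) * R) := by
    rw [sub_pow_char, one_pow, ← pow_mul, ← pow_two] at hR
    rw [sub_pow_char, mul_pow, one_pow]
    linear_combination X ^ p * hR
  rw [hΨ, ← map_pow, h1, Psi₂, hgrp]
  have h2 : grp σ ^ (p ^ 2) = 1 := by
    rw [← hgrp, hσ, grp, map_one]
  simp [h2]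

theorem Psi_eq_pow (p : ℕ) [hp : Fact p.Prime] [CharP K p] (σ : L ≃ₐ[K] L)
    (hσ : σ ^ (p ^ 2) = 1) (μ : K) (a : ℕ) :
    Psi p σ (σ ^ p) μ a = Psi₁ p σ (σ ^ p) μ ^ a := by
  rw [Psi, ← Psi₁_pow_prime p σ hσ μ, ← pow_mul, ← pow_add, Nat.div_add_mod]

open Polynomial in
theorem Psi₁_pow_eq_zero (p : ℕ) [hp : Fact p.Prime] [CharP K p] (σ : L ≃ₐ[K] L)
    (hσ : σ ^ (p ^ 2) = 1) (μ : K) : Psi₁ p σ (σ ^ p) μ ^ (p ^ 2) = 0 := by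
  have hgrp : ∀ k : ℕ, grp (σ ^ k) = grp σ ^ k := fun k => by simp [grp]
  have h1 : Psi₂ (σ ^ p) = aeval (grp σ) (X ^ p - 1 : K[X]) := by
    rw [Psi₂, hgrp]
    simp
  have h2 : grp σ ^ (p ^ 2) = 1 := by
    rw [← hgrp, hσ, grp, map_one]
  rw [pow_two, pow_mul, Psi₁_pow_prime p σ hσ μ, h1, ← map_pow, sub_pow_char, one_pow, ← pow_mul,
    ← pow_two]
  simp [h2]

end GroupAlgebra

theorem isMinDiff_ww (p : ℕ) (b₁ b₂ : ℤ) :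
    IsMinDiff (p ^ 2) (dd p b₁ b₂) (ww p b₁ b₂) := by
  constructor
  · intro j a ha
    exact Finset.inf'_le _ (Finset.mem_range.2 (by omega))
  · intro j
    obtain ⟨a, ha, ha'⟩ := Finset.exists_mem_eq_inf'
      (s := Finset.range (p ^ 2 - j)) (by have := j.2; simp; omega)
      (fun a => dd p b₁ b₂ (j + a) - dd p b₁ b₂ a)
    exact ⟨a, by have := Finset.mem_range.1 ha; omega, ha'⟩

/-- Adapted generators give a scaffold consisting of the powers of `Ψ₁`. -/
theorem AdaptedGenerators.powerScaffold {p : ℕ} [hp : Fact p.Prime] {κ : Type*} [Field κ]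
    [CharP κ p] {L : Type*} [Field L] [Algebra κ⸨X⸩ L] [FiniteDimensional κ⸨X⸩ L]
    [IsGalois κ⸨X⸩ L] {v : AddValuation L (WithTop ℤ)} (hv : IsFullyRamifiedValuation κ v)
    (hdeg : Module.finrank κ⸨X⸩ L = p ^ 2)
    {σ : L ≃ₐ[κ⸨X⸩] L} {μ : κ⸨X⸩} {b₁ b₂ : ℤ} {x y w : L}
    (h : AdaptedGenerators p v σ (σ ^ p) μ b₁ b₂ x y w) {ρ : L}
    (hρ : v ρ = ((b₂ % (p : ℤ) ^ 2 : ℤ) : WithTop ℤ)) :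
    PowerScaffold v (Psi₁ p σ (σ ^ p) μ) (p ^ 2) (dd p b₁ b₂)
      (fun a => bb p b₁ b₂ a % (p : ℤ) ^ 2) ρ := by
  have hp0 := hp.out.pos
  have : CharP κ⸨X⸩ p := charP_of_injective_ringHom (HahnSeries.C : κ →+* κ⸨X⸩).injective p
  have hord : σ ^ (p ^ 2) = 1 := by
    rw [← hdeg, ← IsGalois.card_aut_eq_finrank κ⸨X⸩ L]
    exact pow_card_eq_one'
  have hpp : (0 : ℤ) < (p : ℤ) ^ 2 := by positivity
  refine ⟨hdeg, Psi₁_pow_eq_zero p σ hord μ, fun a ha => ?_, fun a _ => Int.emod_nonneg _ hpp.ne',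
    fun a _ => ?_, fun a ha b hb hab => ?_⟩
  · rw [← Psi_eq_pow p σ hord, h.val_action_Psi_of_val_eq_mod hv hdeg hρ ha, dd_eq p b₁ b₂ a]
    congr 1
    have := Int.emod_add_mul_ediv (bb p b₁ b₂ a) ((p : ℤ) ^ 2)
    push_cast
    linear_combination -this
  · push_cast
    exact Int.emod_lt_of_pos _ hpp
  · have h1 : (p : ℤ) ^ 2 ∣ bb p b₁ b₂ b - bb p b₁ b₂ a := Int.ModEq.dvd hab
    have hda : a / p < p := Nat.div_lt_of_lt_mul (by rwa [pow_two] at ha)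
    have hdb : b / p < p := Nat.div_lt_of_lt_mul (by rwa [pow_two] at hb)
    have h2 := h.index_eq (i := ⟨a / p, hda⟩) (j := ⟨a % p, Nat.mod_lt _ hp0⟩)
      (i' := ⟨b / p, hdb⟩) (j' := ⟨b % p, Nat.mod_lt _ hp0⟩) (by
        convert h1 using 1
        simp only [bb, scaffoldVal]
        ring)
    have h3 : a / p = b / p := congrArg Fin.val h2.1
    have h4 : a % p = b % p := congrArg Fin.val h2.2
    rw [← Nat.div_add_mod a p, ← Nat.div_add_mod b p, h3, h4]

end GaloisScaffold

end

theorem lemma2p2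
    {p : ℕ} [Fact p.Prime]
    {κ : Type*} [Field κ] [CharP κ p] [PerfectField κ]
    {L : Type*} [Field L] [Algebra κ⸨X⸩ L] [IsGalois κ⸨X⸩ L]
    -- a fully ramified Galois extension of degree `p²` with normalized valuation `v₂`
    (hdeg : Module.finrank κ⸨X⸩ L = p ^ 2)
    (v₂ : AddValuation L (WithTop ℤ))
    (hv₂ : GaloisScaffold.IsFullyRamifiedValuation κ v₂)
    -- the Galois group is cyclic, generated by `σ₁`, and `σ₂ = σ₁ ^ p`
    (σ₁ σ₂ : L ≃ₐ[κ⸨X⸩] L)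
    (hσ₁ : ∀ τ : L ≃ₐ[κ⸨X⸩] L, τ ∈ Subgroup.zpowers σ₁)
    (hσ₂ : σ₂ = σ₁ ^ p)
    -- the lower ramification numbers
    (π : L) (hπ : v₂ π = 1)
    (b₁ b₂ : ℤ)
    (hb₁ : v₂ (σ₁ π - π) = ((b₁ + 1 : ℤ) : WithTop ℤ))
    (hb₂ : v₂ (σ₂ π - π) = ((b₂ + 1 : ℤ) : WithTop ℤ))
    -- the Witt vector `(β₁, β₂)`, reduced, and the Artin-Schreier-Witt generators
    (β₁ β₂ : κ⸨X⸩)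
    (hβ₁ : ∀ c : κ⸨X⸩, (β₁ + (c ^ p - c)).orderTop ≤ β₁.orderTop)
    (hβ₂ : ∀ (n : ℤ) (c : κ⸨X⸩), (β₂ + (n * β₁ + (c ^ p - c))).orderTop ≤ β₂.orderTop)
    (x₁ x₂ : L)
    (hx₁ : x₁ ^ p - x₁ = algebraMap κ⸨X⸩ L β₁)
    (hx₂ : x₂ ^ p - x₂ =
      GaloisScaffold.wittPoly p x₁ (algebraMap κ⸨X⸩ L β₁) + algebraMap κ⸨X⸩ L β₂)
    (hσx₁ : σ₁ x₁ - x₁ = 1)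
    (hσx₂ : σ₁ x₂ - x₂ = GaloisScaffold.wittPoly p x₁ 1)
    -- `β₂ = μ^p β₁ + ε`
    (μ ε : κ⸨X⸩)
    (hμε : β₂ = μ ^ p * β₁ + ε)
    (hε : (∃ c : κ, ε = HahnSeries.C c) ∨
      ∃ e : ℤ, 0 < e ∧ ε.orderTop = ((-e : ℤ) : WithTop ℤ) ∧ ¬ (p : ℤ) ∣ e ∧
        ¬ e ≡ b₁ [ZMOD p])
    -- `v₀(ε) > v₀(β₂) + (p-1) b₁ / p` and `v₀(β₁^p) > v₀(β₂) + (p-1) b₁ / p`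
    (hcond₁ : p • β₂.orderTop + ((((p : ℤ) - 1) * b₁ : ℤ) : WithTop ℤ) < p • ε.orderTop)
    (hcond₂ : p • β₂.orderTop + ((((p : ℤ) - 1) * b₁ : ℤ) : WithTop ℤ) <
      p • (β₁ ^ p).orderTop) :
    -- `{t^{-w_j} Ψ^(j)}` is an `𝔒₀`-basis of the associated order
    (LinearIndependent κ⟦X⟧ (fun j : Fin (p ^ 2) =>
        ((HahnSeries.single (1 : ℤ) (1 : κ) : κ⸨X⸩) ^ (-GaloisScaffold.ww p b₁ b₂ j)) •
          GaloisScaffold.Psi p σ₁ σ₂ μ j) ∧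
      (Submodule.span κ⟦X⟧ (Set.range (fun j : Fin (p ^ 2) =>
        ((HahnSeries.single (1 : ℤ) (1 : κ) : κ⸨X⸩) ^ (-GaloisScaffold.ww p b₁ b₂ j)) •
          GaloisScaffold.Psi p σ₁ σ₂ μ j)) : Set (MonoidAlgebra κ⸨X⸩ (L ≃ₐ[κ⸨X⸩] L))) =
        GaloisScaffold.associatedOrder κ⸨X⸩ v₂) ∧
    -- `𝔒₂` is free over the associated order iff `w_j = d_j - d_0` for all `j`
    (Module.Free (GaloisScaffold.associatedOrder κ⸨X⸩ v₂) (GaloisScaffold.valRing v₂) ↔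
      ∀ j : Fin (p ^ 2), GaloisScaffold.ww p b₁ b₂ j =
        GaloisScaffold.dd p b₁ b₂ j - GaloisScaffold.dd p b₁ b₂ 0) ∧
    -- in that case every `ρ` with `v₂(ρ) = r(b₂)` is a free generator
    (Module.Free (GaloisScaffold.associatedOrder κ⸨X⸩ v₂) (GaloisScaffold.valRing v₂) →
      ∀ ρ : L, v₂ ρ = ((b₂ % (p : ℤ) ^ 2 : ℤ) : WithTop ℤ) →
        ∃ hρ : ρ ∈ GaloisScaffold.valRing v₂,
          Function.Bijective (fun α : GaloisScaffold.associatedOrder κ⸨X⸩ v₂ =>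
            α • (⟨ρ, hρ⟩ : GaloisScaffold.valRing v₂))) := by
  have hp0 := (Fact.out : p.Prime).pos
  have hfin : FiniteDimensional κ⸨X⸩ L :=
    Module.finite_of_finrank_pos (by rw [hdeg]; positivity)
  have : CharP κ⸨X⸩ p := charP_of_injective_ringHom (HahnSeries.C : κ →+* κ⸨X⸩).injective p
  subst hσ₂
  have hgen := hv₂.adaptedGenerators hdeg hπ hσ₁ hb₁ hb₂ hβ₁ hx₁ hx₂ hσx₁ hσx₂ hμε hcond₁ hcond₂
  have hscaf := fun ρ hρ => hgen.powerScaffold hv₂ hdeg (ρ := ρ) hρ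
  have hord : σ₁ ^ (p ^ 2) = 1 := by
    rw [← hdeg, ← IsGalois.card_aut_eq_finrank κ⸨X⸩ L]
    exact pow_card_eq_one'
  have hmin := GaloisScaffold.isMinDiff_ww p b₁ b₂
  obtain ⟨ρ₀, hρ₀⟩ := hv₂.normalized (b₂ % (p : ℤ) ^ 2)
  have hmem : ∀ ρ : L, v₂ ρ = ((b₂ % (p : ℤ) ^ 2 : ℤ) : WithTop ℤ) →
      ρ ∈ GaloisScaffold.valRing v₂ := by
    intro ρ hρ
    change 0 ≤ v₂ ρ
    rw [hρ]
    exact_mod_cast Int.emod_nonneg _ (by positivity)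
  refine ⟨?_, ⟨fun hfree j => (hscaf ρ₀ hρ₀).minDiff_eq_of_free hv₂ hmin j, fun hw => ?_⟩,
    fun hfree ρ hρ => ⟨hmem ρ hρ, (hscaf ρ hρ).bijective_smul hv₂ hmin
      (fun j => (hscaf ρ₀ hρ₀).minDiff_eq_of_free hv₂ hmin j) (hmem ρ hρ)⟩⟩
  · simp only [GaloisScaffold.Psi_eq_pow p σ₁ hord μ]
    exact (hscaf ρ₀ hρ₀).basis_associatedOrder hv₂ hmin
  · exact Module.Free.of_equiv (LinearEquiv.ofBijective
      (LinearMap.toSpanSingleton (GaloisScaffold.associatedOrder κ⸨X⸩ v₂)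
        (GaloisScaffold.valRing v₂) ⟨ρ₀, hmem ρ₀ hρ₀⟩)
      ((hscaf ρ₀ hρ₀).bijective_smul hv₂ hmin hw (hmem ρ₀ hρ₀)))
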